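/- Let $d\ge 3$, $r\ge 2$ and $n\ge r^2$. For $Q\in\mathbb{C}^{n\times r\times r}$ with slices $Q^{(1)},\dots,Q^{(n)}\in\mathbb{C}^{r\times r}$ let $T=T_Q\in\mathbb{C}^{n^{\times d}}$ be the symmetric tensor ring $T(i_1,\dots,i_d)=\operatorname{tr}(Q^{(i_1)}\cdots Q^{(i_d)})$. Two $d$-tuples of cores are gauge equivalent, $(Q_k)_{k}\sim(Q_k')_{k}$, if there are $L_1,\dots,L_d\in GL(r,\mathbb{C})$ with $Q_k'^{(a)}=L_k^{-1}Q_k^{(a)}L_{k+1}$ for all $k$ and $a$ (indices mod $d$). *Sampling.* A sampling choice consists of $\alpha,\beta,\alpha',\beta'\in[n]^{d-2}$ with $\alpha\ne\beta$, $\alpha'\ne\beta'$, $\{\alpha,\beta\}\ne\{\alpha',\beta'\}$, of $m\in[n]$, and of sets $\Gamma,\Gamma',\Gamma_\gamma\subseteq[n]$ of size $r^2$. The algorithm sees only the entries of the five $n\times r^2$ matrices $T(:,\alpha,\Gamma)$, $T(:,\beta,\Gamma)$, $T(:,\alpha',\Gamma')$, $T(:,\beta',\Gamma')$, $N=T(:,m,\dots,m,\Gamma_\gamma)$,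 where $T(:,\alpha,\Gamma)$ has the entries $T(a,\alpha,c)$, $a\in[n]$, $c\in\Gamma$. *Algorithm BLOSTR-S.* ($A^\dagger$ is the Moore–Penrose inverse; $C_{\langle1\rangle}$ and $C_{[1]}$ are the $n\times r^2$ unfoldings of a core $C$ with $C_{\langle1\rangle}(a,(j-1)r+k)=C_{[1]}(a,(k-1)r+j)=C(a,j,k)$.) 1. Find $E,E'\in\mathbb{C}^{n\times r^2}$ with linearly independent columns which are eigenvectors of $T(:,\alpha,\Gamma)T(:,\beta,\Gamma)^\dagger$ and $T(:,\alpha',\Gamma')T(:,\beta',\Gamma')^\dagger$, respectively, for $r$ distinct nonzero eigenvalues, the columns $t,r+t,\dots,(r-1)r+t$ belonging to the $t$-th eigenvalue. Let $F=E^\dagger E'$, and let $F^{(j,k)}$ be its $r\times r$ submatrix with rows $j,r+j,\dots$ and columns $k,r+k,\dots$. Put $\hat K_1=I$, $\hat K_t=F^{(1,1)}(F^{(t,1)})^{-1}$ for $2\le t\le r$; let $\Pi(\hat K)$ be the $r^2\times r^2$ matrix with entry $(\hat K_t)_{jk}$ at $((j-1)r+t,(k-1)r+t)$ and zeros elsewhere;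 define $\hat Q_1$ by $\hat Q_{1\langle1\rangle}=E\,\Pi(\hat K)^{-1}$. 2. For $k=2,\dots,d$ define $\hat Q_k$ by $\hat Q_{k\langle1\rangle}=N\bigl((I_r\otimes\hat Q_1^{(m)}\cdots\hat Q_{k-2}^{(m)})\,\hat Q_{(k-1)[1]}^{\top}(:,\Gamma_\gamma)\bigr)^\dagger$ (the product is $I_r$ for $k=2$). 3. Find an eigendecomposition $\hat Q_1^{(1)}\hat Q_2^{(1)}\cdots\hat Q_d^{(1)}=Y\operatorname{diag}(\lambda_1,\dots,\lambda_r)Y^{-1}$, and write $\lambda_t=\ell_te^{i\theta_t}$ with $\ell_t\ge0$, $\theta_t\in[0,2\pi)$. 4. Search over $k_1=0$ and $(k_2,\dots,k_r)\in\{0,\dots,d-1\}^{r-1}$: let $\bar Q^{(1)}=Y\operatorname{diag}(\ell_t^{1/d}e^{i(\theta_t+2k_t\pi)/d})_tY^{-1}$ and $\bar Q^{(j)}=(\bar Q^{(1)})^{-(d-1)}\hat Q_1^{(1)}\cdots\hat Q_{d-1}^{(1)}\hat Q_d^{(j)}$ for $j\ge2$, until $\hat Q_1^{(i_1)}\cdots\hat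 Q_d^{(i_d)}=\bar Q^{(i_1)}\cdots\bar Q^{(i_d)}$ for all $(i_1,\dots,i_d)\in[n]^d$. Return $\tilde Q=\bar Q$. A run is completed if all matrices inverted in it are invertible and the search ends. Write $R^\alpha=Q^{(\alpha_1)}\cdots Q^{(\alpha_{d-2})}$. A sampling choice is called nondegenerate if there is at least one core for which $R^\beta,R^{\beta'}$ are invertible, $R^\alpha(R^\beta)^{-1}=U\Lambda U^{-1}$ and $R^{\alpha'}(R^{\beta'})^{-1}=V\Lambda'V^{-1}$ with $\Lambda,\Lambda'$ diagonal with distinct diagonal entries, and $U^{-1}V$ has no zero entry. **Theorem.** Let the entries of $Q$ be random with a joint law $\mu$ on $\mathbb{C}^{n\times r\times r}$ that is absolutely continuous with respect to Lebesgue measure. Then: (a) With probability one, for every sampling choice, every completed run of BLOSTR-S on the observed entries of $T_Q$ returns a core $\tilde Q$ with $(\tilde Q,\dots,\tilde Q)\sim(Q,\dots,Q)$. (b) For every nondegenerate sampling choice, with probability one, BLOSTR-S can always be carried out: $E,E'$ exist; for all such $E,E'$ the blocks $F^{(t,1)}$, $2\le t\le r$, are invertible and the eigendecomposition in step 3 exists;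 and for each such eigendecomposition all the $\bar Q^{(1)}$ are invertible and some $(k_2,\dots,k_r)$ passes the test. (c) A sampling choice is nondegenerate whenever $\alpha,\beta$ differ only in their first index, $\alpha',\beta'$ differ only in their first index, and $\{\alpha_1,\beta_1\}\ne\{\alpha'_1,\beta'_1\}$ (for $d=3$: always); such sampling choices exist. (d) For every sampling choice, at most $5nr^2$ entries of $T$ are observed. -/

import Mathlib

open MeasureTheory Matrix
open scoped Kronecker

namespace TensorRing

/-! ### Tensor rings and gauge equivalence -/

/-- A three-way core of size `n × r × r`, given by its `n` slices. -/
abbrev Core (n r : ℕ) : Type := Fin n → Matrix (Fin r) (Fin r) ℂ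

/-- The core whose entries are the given numbers. -/
def toCore {n r : ℕ} (x : Fin n → Fin r → Fin r → ℂ) : Core n r := fun a => Matrix.of (x a)

/-- The entries of the symmetric tensor ring of order `d` with the single core `Q`. -/
def symTensor {n r : ℕ} (d : ℕ) (Q : Core n r) (i : Fin d → Fin n) : ℂ :=
  (List.ofFn fun k => Q (i k)).prod.trace

/-- Gauge equivalence of two tuples of `d` cores, with cyclic indices. -/
def GaugeEquiv {n r d : ℕ} (Q Q' : Fin d → Core n r) : Prop :=
  ∃ L : Fin d → GL (Fin r) ℂ, ∀ (k : Fin d) (a : Fin n),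
    Q' k a = ((L k)⁻¹ : GL (Fin r) ℂ).val * Q k a * (L (finRotate d k)).val

/-! ### Linear algebra -/

/-- Penrose's four equations: `B` is the Moore-Penrose inverse of `A`. -/
structure IsMoorePenrose {l m : Type*} [Fintype l] [Fintype m]
    (A : Matrix l m ℂ) (B : Matrix m l ℂ) : Prop where
  left : A * B * A = A
  right : B * A * B = B
  hermLeft : (A * B)ᴴ = A * B
  hermRight : (B * A)ᴴ = B * A

theorem IsMoorePenrose.unique {l m : Type*} [Fintype l] [Fintype m]
    {A : Matrix l m ℂ} {B C : Matrix m l ℂ}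
    (hB : IsMoorePenrose A B) (hC : IsMoorePenrose A C) : B = C := by
  have h1 : A * B = A * C := by
    calc A * B = (A * B)ᴴ := hB.hermLeft.symm
      _ = (A * C * (A * B))ᴴ := by rw [← Matrix.mul_assoc, hC.left]
      _ = (A * B)ᴴ * (A * C)ᴴ := Matrix.conjTranspose_mul _ _
      _ = A * C := by rw [hB.hermLeft, hC.hermLeft, ← Matrix.mul_assoc, hB.left]
  have h2 : B * A = C * A := by
    calc B * A = (B * A)ᴴ := hB.hermRight.symm
      _ = (B * A * (C * A))ᴴ := by
        rw [Matrix.mul_assoc, ← Matrix.mul_assoc A, hC.left]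
      _ = (C * A)ᴴ * (B * A)ᴴ := Matrix.conjTranspose_mul _ _
      _ = C * A := by
        rw [hB.hermRight, hC.hermRight, Matrix.mul_assoc, ← Matrix.mul_assoc A, hB.left]
  calc B = B * A * B := hB.right.symm
    _ = C * A * C := by rw [h2, Matrix.mul_assoc, h1, ← Matrix.mul_assoc]
    _ = C := hC.right

open Classical in
/-- The Moore-Penrose inverse `A†`. -/
noncomputable def pinv {l m : Type*} [Fintype l] [Fintype m] (A : Matrix l m ℂ) :
    Matrix m l ℂ :=
  if h : ∃ B, IsMoorePenrose A B then h.choose else 0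

/-- The unfolding `Q_⟨1⟩`: the column of the pair `(j, k)`, which stands for the position
`(j - 1) r + k`, holds the entries `Q(a, j, k)`. -/
def unfoldAngle {n r : ℕ} (Q : Core n r) : Matrix (Fin n) (Fin r × Fin r) ℂ :=
  Matrix.of fun a p => Q a p.1 p.2

/-- The unfolding `Q_[1]`: the column of the pair `(k, j)`, which stands for the position
`(k - 1) r + j`, holds the entries `Q(a, j, k)`. -/
def unfoldSquare {n r : ℕ} (Q : Core n r) : Matrix (Fin n) (Fin r × Fin r) ℂ :=
  Matrix.of fun a p => Q a p.2 p.1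

/-- The inverse of `unfoldAngle`. -/
def foldAngle {n r : ℕ} (M : Matrix (Fin n) (Fin r × Fin r) ℂ) : Core n r :=
  fun a => Matrix.of fun j k => M a (j, k)

/-- `E` is an eigenbasis for the nonzero spectrum of `M`, which consists of `r` distinct
eigenvalues of multiplicity `r`. The column of the pair `(j, t)`, which stands for the position
`(j - 1) r + t`, is the `j`-th chosen eigenvector of the `t`-th eigenvalue. -/
def IsEigenbasis {n r : ℕ} (M : Matrix (Fin n) (Fin n) ℂ)
    (E : Matrix (Fin n) (Fin r × Fin r) ℂ) : Prop :=
  ∃ ev : Fin r → ℂ, Function.Injective ev ∧ (∀ t, ev t ≠ 0) ∧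
    LinearIndependent ℂ E.col ∧ M * E = E * Matrix.diagonal fun p => ev p.2

/-- `H = Y diag(ev) Y⁻¹`. -/
def IsEigendecomposition {r : ℕ} (H Y : Matrix (Fin r) (Fin r) ℂ) (ev : Fin r → ℂ) : Prop :=
  IsUnit Y ∧ H = Y * Matrix.diagonal ev * Y⁻¹

/-- The argument of `z` in `[0, 2π)`. -/
noncomputable def angle (z : ℂ) : ℝ :=
  if 0 ≤ z.arg then z.arg else z.arg + 2 * Real.pi

/-- The `d`-th root `ℓ^{1/d} exp(i (θ + 2kπ) / d)` of `z = ℓ exp(i θ)`, with `θ ∈ [0, 2π)`. -/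
noncomputable def dthRoot (d : ℕ) (z : ℂ) (k : ℕ) : ℂ :=
  ((‖z‖ ^ (1 / (d : ℝ)) : ℝ) : ℂ) *
    Complex.exp (Complex.I * (((angle z + 2 * k * Real.pi) / d : ℝ) : ℂ))

/-! ### Sampled entries -/

/-- The multi-index `(a, α₂, …, α_{d-1}, c)`. -/
def fullIndex {n d : ℕ} (a : Fin n) (α : Fin (d - 2) → Fin n) (c : Fin n) : Fin d → Fin n :=
  fun i => if h0 : i.val = 0 then a else if h1 : i.val = d - 1 then c
    else α ⟨i.val - 1, by have := i.isLt; omega⟩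

/-- The positions of the entries of `T(:, α, Γ)`. -/
def block {n : ℕ} (d : ℕ) (α : Fin (d - 2) → Fin n) (Γ : Finset (Fin n)) :
    Finset (Fin d → Fin n) :=
  (Finset.univ ×ˢ Γ).image fun p : Fin n × Fin n => fullIndex p.1 α p.2

theorem fullIndex_mem_block {n d : ℕ} (a : Fin n) (α : Fin (d - 2) → Fin n)
    (Γ : Finset (Fin n)) (c : Γ) : fullIndex a α c.val ∈ block d α Γ :=
  Finset.mem_image.2
    ⟨(a, c.val), Finset.mem_product.2 ⟨Finset.mem_univ a, c.property⟩, rfl⟩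

/-- The choices that determine which entries the algorithm reads: two pairs of middle indices,
the constant middle index `γ = (m, …, m)`, and the sets of columns. The two slices of one
spectral probe share their set of columns. -/
structure Sampling (n d r : ℕ) where
  α : Fin (d - 2) → Fin n
  β : Fin (d - 2) → Fin n
  α' : Fin (d - 2) → Fin n
  β' : Fin (d - 2) → Fin n
  m : Fin n
  Γ : Finset (Fin n)
  Γ' : Finset (Fin n)
  Γγ : Finset (Fin n)
  card_Γ : Γ.card = r ^ 2
  card_Γ' : Γ'.card = r ^ 2
  card_Γγ : Γγ.card = r ^ 2
  ne : α ≠ β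
  ne' : α' ≠ β'
  pair_ne : ({α, β} : Set (Fin (d - 2) → Fin n)) ≠ {α', β'}

namespace Sampling

variable {n d r : ℕ}

/-- The set of observed positions. -/
def positions (s : Sampling n d r) : Finset (Fin d → Fin n) :=
  block d s.α s.Γ ∪ block d s.β s.Γ ∪ (block d s.α' s.Γ' ∪ block d s.β' s.Γ') ∪
    block d (fun _ => s.m) s.Γγ

/-- What the algorithm is given: the values at the observed positions, and nothing else. -/
abbrev Data (s : Sampling n d r) : Type := s.positions → ℂ

/-- The data of a tensor. -/
def observe (s : Sampling n d r) (T : (Fin d → Fin n) → ℂ) : s.Data := fun i => T i.val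

/-- The observed matrix `T(:, α, Γ)`. -/
def slice (s : Sampling n d r) (D : s.Data) (α : Fin (d - 2) → Fin n) (Γ : Finset (Fin n))
    (h : block d α Γ ⊆ s.positions) : Matrix (Fin n) Γ ℂ :=
  Matrix.of fun a c => D ⟨fullIndex a α c.val, h (fullIndex_mem_block a α Γ c)⟩

def sliceα (s : Sampling n d r) (D : s.Data) : Matrix (Fin n) s.Γ ℂ :=
  s.slice D s.α s.Γ fun i hi => by simp [positions, hi]

def sliceβ (s : Sampling n d r) (D : s.Data) : Matrix (Fin n) s.Γ ℂ :=
  s.slice D s.β s.Γ fun i hi => by simp [positions, hi]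

def sliceα' (s : Sampling n d r) (D : s.Data) : Matrix (Fin n) s.Γ' ℂ :=
  s.slice D s.α' s.Γ' fun i hi => by simp [positions, hi]

def sliceβ' (s : Sampling n d r) (D : s.Data) : Matrix (Fin n) s.Γ' ℂ :=
  s.slice D s.β' s.Γ' fun i hi => by simp [positions, hi]

def sliceγ (s : Sampling n d r) (D : s.Data) : Matrix (Fin n) s.Γγ ℂ :=
  s.slice D (fun _ => s.m) s.Γγ fun i hi => by simp [positions, hi]

end Sampling

/-! ### BLOSTR -/

/-- The block `F^{(j,k)}` of `F = E† E'`. -/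
noncomputable def probeBlock {n r : ℕ} (E E' : Matrix (Fin n) (Fin r × Fin r) ℂ) (j k : Fin r) :
    Matrix (Fin r) (Fin r) ℂ :=
  Matrix.of fun a b => (pinv E * E') (a, j) (b, k)

/-- The gauge matrices `K̂₁ = I` and `K̂_ℓ = F^{(1,1)} (F^{(ℓ,1)})⁻¹`. -/
noncomputable def gaugeBlock {n r : ℕ} [NeZero r] (E E' : Matrix (Fin n) (Fin r × Fin r) ℂ)
    (t : Fin r) : Matrix (Fin r) (Fin r) ℂ :=
  if t = 0 then 1 else probeBlock E E' 0 0 * (probeBlock E E' t 0)⁻¹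

/-- The first core, `Q̂_{1⟨1⟩} = E (Π(K̂))⁻¹`. Here `Π(K̂)` is the matrix whose entry at
`((j, t), (k, t'))` is `(K̂_t)_{jk}` if `t = t'`, and `0` otherwise. -/
noncomputable def firstCore {n r : ℕ} [NeZero r] (E E' : Matrix (Fin n) (Fin r × Fin r) ℂ) :
    Core n r :=
  foldAngle (E * (Matrix.blockDiagonal (gaugeBlock E E'))⁻¹)

/-- The core that follows `C`, given the matrix `N` of the cyclically shifted tensor and the
product `P` of the slices at `γ` of all the cores before `C`:
`N ((I ⊗ P) C_[1]ᵀ(:, Γ))†`, folded. -/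
noncomputable def nextCore {n r : ℕ} {Γ : Finset (Fin n)} (N : Matrix (Fin n) Γ ℂ)
    (P : Matrix (Fin r) (Fin r) ℂ) (C : Core n r) : Core n r :=
  foldAngle (N * pinv (((1 : Matrix (Fin r) (Fin r) ℂ) ⊗ₖ P) *
    (unfoldSquare C)ᵀ.submatrix id (fun c : Γ => c.val)))

/-- The loop over the cores, numbered from `0`: after `k` steps, the core number `k` and the
product of the slices at `γ` of the cores before it. Each step reads the observed matrix `N k`. -/
noncomputable def coreLoop {n r : ℕ} {Γ : Finset (Fin n)} (N : ℕ → Matrix (Fin n) Γ ℂ)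
    (γ : ℕ → Fin n) (C₀ : Core n r) : ℕ → Core n r × Matrix (Fin r) (Fin r) ℂ
  | 0 => (C₀, 1)
  | k + 1 =>
    (nextCore (N k) (coreLoop N γ C₀ k).2 (coreLoop N γ C₀ k).1,
      (coreLoop N γ C₀ k).2 * (coreLoop N γ C₀ k).1 (γ k))

namespace Sampling

variable {n d r : ℕ}

/-- The outcome of the two eigendecompositions, the spectral probes. -/
def IsProbe (s : Sampling n d r) (D : s.Data) (E E' : Matrix (Fin n) (Fin r × Fin r) ℂ) : Prop :=
  IsEigenbasis (s.sliceα D * pinv (s.sliceβ D)) E ∧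
    IsEigenbasis (s.sliceα' D * pinv (s.sliceβ' D)) E'

/-- The blocks that are inverted after the spectral probes are invertible. -/
def ProbeInvertible (E E' : Matrix (Fin n) (Fin r × Fin r) ℂ) [NeZero r] : Prop :=
  ∀ t : Fin r, t ≠ 0 → IsUnit (probeBlock E E' t 0)

/-- The cores `Q̂₁, …, Q̂_d` (numbered from `0`) that BLOSTR computes. A tensor with a single core
is invariant under cyclic shifts, so with `γ = (m, …, m)` the matrix that is read in each step of
the loop is `T(:, γ, Γ_γ)`. -/
noncomputable def cores [NeZero r] (s : Sampling n d r) (D : s.Data)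
    (E E' : Matrix (Fin n) (Fin r × Fin r) ℂ) (k : ℕ) : Core n r :=
  (coreLoop (fun _ => s.sliceγ D) (fun _ => s.m) (firstCore E E') k).1

/-! ### BLOSTR-S -/

/-- The product `Q̂₁^{(i₁)} ⋯ Q̂_d^{(i_d)}`. -/
noncomputable def coreProd [NeZero r] (s : Sampling n d r) (D : s.Data)
    (E E' : Matrix (Fin n) (Fin r × Fin r) ℂ) (i : Fin d → Fin n) : Matrix (Fin r) (Fin r) ℂ :=
  (List.ofFn fun k : Fin d => s.cores D E E' k.val (i k)).prod

/-- The candidate for the first slice, `Y diag(ω₁, …, ω_r) Y⁻¹`, where `ω_t` is the `d`-th root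
number `k t` of the eigenvalue `ev t`. -/
noncomputable def candidateHead (d : ℕ) {r : ℕ} (Y : Matrix (Fin r) (Fin r) ℂ) (ev : Fin r → ℂ)
    (k : Fin r → Fin d) : Matrix (Fin r) (Fin r) ℂ :=
  Y * Matrix.diagonal (fun t => dthRoot d (ev t) (k t).val) * Y⁻¹

/-- The candidate core `Q̄`: its first slice is `Q̄^{(1)} = candidateHead`, the others are
`(Q̄^{(1)})^{-(d-1)} Q̂₁^{(1)} ⋯ Q̂_{d-1}^{(1)} Q̂_d^{(j)}`. -/
noncomputable def candidate [NeZero n] [NeZero r] (s : Sampling n d r) (D : s.Data)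
    (E E' : Matrix (Fin n) (Fin r × Fin r) ℂ) (Y : Matrix (Fin r) (Fin r) ℂ) (ev : Fin r → ℂ)
    (k : Fin r → Fin d) : Core n r :=
  fun j => if j = 0 then candidateHead d Y ev k
    else (candidateHead d Y ev k ^ (d - 1))⁻¹ *
      s.coreProd D E E' (fun t => if t.val = d - 1 then j else 0)

/-- The test that ends the search: `Q̂₁^{(i₁)} ⋯ Q̂_d^{(i_d)} = Q̄^{(i₁)} ⋯ Q̄^{(i_d)}` for all
multi-indices. It reads no entry of the tensor. -/
def Accepts [NeZero r] (s : Sampling n d r) (D : s.Data)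
    (E E' : Matrix (Fin n) (Fin r × Fin r) ℂ) (C : Core n r) : Prop :=
  ∀ i : Fin d → Fin n, s.coreProd D E E' i = (List.ofFn fun t => C (i t)).prod

/-- A completed run of BLOSTR-S: one outcome of each of the choices that the algorithm leaves
open, such that every matrix it inverts is invertible and the search ends with success. -/
structure Run [NeZero n] [NeZero r] (s : Sampling n d r) (D : s.Data) where
  E : Matrix (Fin n) (Fin r × Fin r) ℂ
  E' : Matrix (Fin n) (Fin r × Fin r) ℂ
  probe : s.IsProbe D E E'
  probe_invertible : ProbeInvertible E E'
  Y : Matrix (Fin r) (Fin r) ℂ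
  ev : Fin r → ℂ
  eigen : IsEigendecomposition (s.coreProd D E E' fun _ => 0) Y ev
  k : Fin r → Fin d
  k_zero : (k 0).val = 0
  head_invertible : IsUnit (candidateHead d Y ev k)
  accepts : s.Accepts D E E' (s.candidate D E E' Y ev k)

/-- The core that a run returns. -/
noncomputable def Run.output [NeZero n] [NeZero r] {s : Sampling n d r} {D : s.Data}
    (R : s.Run D) : Core n r :=
  s.candidate D R.E R.E' R.Y R.ev R.k

/-- The algorithm cannot get stuck on the data `D`: each step can be carried out, whatever the
outcomes of the steps before it were, and the search over the roots meets a candidate that passes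
the test. -/
def Completes [NeZero n] [NeZero r] (s : Sampling n d r) (D : s.Data) : Prop :=
  (∃ E E', s.IsProbe D E E') ∧
    ∀ E E', s.IsProbe D E E' →
      ProbeInvertible E E' ∧
      (∃ Y ev, IsEigendecomposition (s.coreProd D E E' fun _ => 0) Y ev) ∧
      ∀ Y ev, IsEigendecomposition (s.coreProd D E E' fun _ => 0) Y ev →
        (∀ k : Fin r → Fin d, (k 0).val = 0 → IsUnit (candidateHead d Y ev k)) ∧
        ∃ k : Fin r → Fin d, (k 0).val = 0 ∧ s.Accepts D E E' (s.candidate D E E' Y ev k)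

/-! ### Choices of the middle indices -/

/-- The product `R^α` of the slices of a core along a middle index. -/
def midProd (Q : Core n r) (α : Fin (d - 2) → Fin n) : Matrix (Fin r) (Fin r) ℂ :=
  (List.ofFn fun k => Q (α k)).prod

/-- The choice of the middle indices is not degenerate for every core: for at least one core,
`R^α (R^β)⁻¹` and `R^{α'} (R^{β'})⁻¹` have simple spectra, and no entry of the change of basis
between their eigenbases is zero. For instance, `α = (1,1)`, `β = (2,1)`, `α' = (1,2)`,
`β' = (2,2)` is degenerate, since the two matrices are then equal for all cores. -/
def Nondegenerate (s : Sampling n d r) : Prop :=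
  ∃ (Q : Core n r) (U V : Matrix (Fin r) (Fin r) ℂ) (u v : Fin r → ℂ),
    IsUnit (midProd Q s.β) ∧ IsUnit (midProd Q s.β') ∧
    IsEigendecomposition (midProd Q s.α * (midProd Q s.β)⁻¹) U u ∧ Function.Injective u ∧
    IsEigendecomposition (midProd Q s.α' * (midProd Q s.β')⁻¹) V v ∧ Function.Injective v ∧
    ∀ i j, (U⁻¹ * V) i j ≠ 0

/-- Each of the two pairs differs in its first index only, and the two pairs of first indices
differ. For `d = 3` this holds for every choice. -/
def DiffersInFirst (s : Sampling n d r) : Prop :=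
  (∀ i : Fin (d - 2), i.val ≠ 0 → s.α i = s.β i ∧ s.α' i = s.β' i) ∧
    ∀ i : Fin (d - 2), i.val = 0 → ({s.α i, s.β i} : Set (Fin n)) ≠ {s.α' i, s.β' i}

end Sampling

end TensorRing

namespace TensorRing

/-! ### Zero sets of polynomials -/

/-! Let `A = unfoldAngle Q` and `S = squareCols Q Γ`. Every observed matrix factors as `T(:, α, Γ) =
A (1 ⊗ R^α) S`. For a regular core, `A` has full column rank and `S` is invertible, so a spectral
probe sees `A (1 ⊗ R^α (R^β)⁻¹) A†`. With `R^α (R^β)⁻¹ = U Λ U⁻¹`, its eigenvectors are known up to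
an arbitrary invertible mixing `K t` inside each eigenspace: `E = A (1 ⊗ U) Π(K)`, and likewise `E'
= A (1 ⊗ V) Π(K')` for the second probe. In `E† E'` the factor `A` cancels, and the block `(j, k)`
is `(U⁻¹ V)_{jk} K_j⁻¹ K'_k`. Quotients of such blocks therefore reveal every `K_t` relative to
`K_0` up to a scalar, which is enough to undo the mixing: the first computed core is `Q` up to a
left and a right gauge (`firstCore_eq`).

Each later core solves a linear system whose solution is again a gauge transform of `Q`; the gauges
close up cyclically, so all products of computed slices are those of `Q` conjugated by one matrix
`G` (`coreLoop_eq`, `coreProd_eq`).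

Correctness then rests only on the final test: a core with the same products up to one conjugation
is gauge equivalent to `Q` (`gaugeEquiv_of_prod_eq`). Completion uses in addition that `Q 0 ^ d` has
a simple spectrum, so that its `d`-th roots arise from roots of its eigenvalues; some choice of
these gives the conjugate of `Q 0` times a root of unity (`exists_candidateHead_eq`).

Regularity, simple spectra and the nonvanishing of the entries of `U⁻¹ V` are all expressed by
nonvanishing polynomials in the entries of `Q`. One witness core per polynomial makes it nonzero
almost everywhere (`ae_evalCore_ne_zero`), hence almost surely for an absolutely continuous law. -/

/-- Fubini in polar style: zeros are null along each line through `p`, so for almost every `t` they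
are null among the directions `v`. One such `t ≠ 0` suffices, since scaling by `t` and translating
by `p` preserve null sets. -/
theorem ae_ne_zero_of_countable_on_lines {E : Type*} [NormedAddCommGroup E] [NormedSpace ℝ E]
    [FiniteDimensional ℝ E] [MeasurableSpace E] [BorelSpace E] (μ : Measure E)
    [μ.IsAddHaarMeasure] {f : E → ℂ} (hf : Continuous f) (p : E)
    (h : ∀ v : E, {t : ℝ | f (p + t • v) = 0}.Countable) : ∀ᵐ x ∂μ, f x ≠ 0 := by
  have h1 : ∀ᵐ v ∂μ, ∀ᵐ t : ℝ, f (p + t • v) ≠ 0 := by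
    refine Filter.Eventually.of_forall fun v => ?_
    rw [ae_iff]
    simpa using (h v).measure_zero volume
  have hm : MeasurableSet {x : E × ℝ | f (p + x.2 • x.1) ≠ 0} := by
    have : Continuous fun x : E × ℝ => f (p + x.2 • x.1) := by fun_prop
    exact (isOpen_ne_fun this continuous_const).measurableSet
  rw [Measure.ae_ae_comm (p := fun v t => f (p + t • v) ≠ 0) hm] at h1
  have h2 : ∀ᵐ t : ℝ, t ≠ 0 := by simp [ae_iff]
  obtain ⟨t, ht, ht0⟩ := (h1.and h2).exists
  have h3 : μ ((fun v => t • v) ⁻¹' {v | f (p + v) = 0}) = 0 := by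
    rw [ae_iff] at ht
    simpa using ht
  rw [Measure.addHaar_preimage_smul μ ht0] at h3
  have h4 : μ {v | f (p + v) = 0} = 0 := by
    rcases mul_eq_zero.1 h3 with h | h
    · simp [ht0] at h
    · exact h
  rw [ae_iff]
  have h5 := measure_preimage_add μ p {x | f x = 0}
  simp only [not_not]
  rw [← h5]
  exact h4

/-- The core whose entries are independent variables. -/
noncomputable def varCore (n r : ℕ) (a : Fin n) :
    Matrix (Fin r) (Fin r) (MvPolynomial (Fin n × Fin r × Fin r) ℂ) :=
  Matrix.of fun j k => MvPolynomial.X (a, j, k)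

/-- Evaluation of a polynomial at the entries of a core. -/
noncomputable def evalCore {n r : ℕ} (Q : Core n r) :
    MvPolynomial (Fin n × Fin r × Fin r) ℂ →+* ℂ :=
  MvPolynomial.eval fun p => Q p.1 p.2.1 p.2.2

theorem map_varCore {n r : ℕ} (Q : Core n r) (a : Fin n) :
    (varCore n r a).map (evalCore Q) = Q a := by
  ext j k
  simp [varCore, evalCore]

/-- On a real line through a core where `P` does not vanish, `P` becomes a nonzero polynomial in one
variable, which has finitely many roots. -/
theorem ae_evalCore_ne_zero {n r : ℕ} (P : MvPolynomial (Fin n × Fin r × Fin r) ℂ)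
    (hP : ∃ Q : Core n r, evalCore Q P ≠ 0) :
    ∀ᵐ x : Fin n → Fin r → Fin r → ℂ, evalCore (toCore x) P ≠ 0 := by
  obtain ⟨Q, hQ⟩ := hP
  have hr : (volume : Measure (Fin r → Fin r → ℂ)).IsAddHaarMeasure :=
    Measure.pi.isAddHaarMeasure _
  have hnr : (volume : Measure (Fin n → Fin r → Fin r → ℂ)).IsAddHaarMeasure :=
    Measure.pi.isAddHaarMeasure _
  refine ae_ne_zero_of_countable_on_lines volume (f := fun x => evalCore (toCore x) P) ?_
    (fun a j k => Q a j k) fun v => ?_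
  · refine (MvPolynomial.continuous_eval P).comp ?_
    simp only [toCore, Matrix.of_apply]
    fun_prop
  · let g : Polynomial ℂ := MvPolynomial.eval₂ Polynomial.C
      (fun p => Polynomial.C (Q p.1 p.2.1 p.2.2) + Polynomial.X * Polynomial.C (v p.1 p.2.1 p.2.2)) P
    have hg : ∀ t : ℝ, g.eval (t : ℂ) =
        evalCore (toCore ((fun a j k => Q a j k) + t • v)) P := by
      intro t
      have := MvPolynomial.hom_eval₂ P Polynomial.C (Polynomial.evalRingHom (t : ℂ))
        (fun p : Fin n × Fin r × Fin r => Polynomial.C (Q p.1 p.2.1 p.2.2) +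
          Polynomial.X * Polynomial.C (v p.1 p.2.1 p.2.2))
      rw [Polynomial.coe_evalRingHom] at this
      rw [this, evalCore, MvPolynomial.eval, MvPolynomial.coe_eval₂Hom]
      have hC : (Polynomial.evalRingHom (t : ℂ)).comp Polynomial.C = RingHom.id ℂ := by
        ext
        simp
      rw [hC]
      congr 1
      ext p
      simp only [Polynomial.eval_add, Polynomial.eval_C, Polynomial.eval_mul, Polynomial.eval_X,
        toCore, Matrix.of_apply, Pi.add_apply, Pi.smul_apply, Complex.real_smul]
    have hg0 : g ≠ 0 := by
      intro h0
      apply hQ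
      have := hg 0
      rw [h0] at this
      simp only [Polynomial.eval_zero, zero_smul, add_zero] at this
      rw [this]
      rfl
    have hfin : {t : ℝ | g.eval (t : ℂ) = 0}.Finite := by
      have := (Polynomial.finite_setOfPred_isRoot hg0).preimage
        (f := fun t : ℝ => (t : ℂ)) (Complex.ofReal_injective.injOn)
      exact this
    refine (hfin.subset fun t ht => ?_).countable
    exact (hg t).trans ht

/-! ### Simple spectra -/

/-- The determinant of `p'(M)`, for the characteristic polynomial `p` of `M`. -/
noncomputable def discrDet {R : Type*} [CommRing R] {r : ℕ} (M : Matrix (Fin r) (Fin r) R) : R :=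
  (Polynomial.aeval M M.charpoly.derivative).det

theorem map_discrDet {R S : Type*} [CommRing R] [CommRing S] {r : ℕ} (f : R →+* S)
    (M : Matrix (Fin r) (Fin r) R) : f (discrDet M) = discrDet (M.map f) := by
  rw [discrDet, discrDet, RingHom.map_det, Matrix.charpoly_map, Polynomial.derivative_map]
  congr 1
  rw [Polynomial.aeval_def, Polynomial.hom_eval₂, Polynomial.aeval_def, Polynomial.eval₂_map]
  have : f.mapMatrix.comp (algebraMap R (Matrix (Fin r) (Fin r) R)) =
      (algebraMap S (Matrix (Fin r) (Fin r) S)).comp f := by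
    ext x i j
    simp only [RingHom.comp_apply, RingHom.mapMatrix_apply, Matrix.map_apply,
      Matrix.algebraMap_matrix_apply]
    split_ifs <;> simp
  rw [this]
  rfl

theorem aeval_conj_diagonal {r : ℕ} {U : Matrix (Fin r) (Fin r) ℂ} (hU : IsUnit U)
    (ev : Fin r → ℂ) (p : Polynomial ℂ) :
    Polynomial.aeval (U * Matrix.diagonal ev * U⁻¹) p =
      U * Matrix.diagonal (fun t => p.eval (ev t)) * U⁻¹ := by
  have hU' : IsUnit U.det := (Matrix.isUnit_iff_isUnit_det _).1 hU
  induction p using Polynomial.induction_on' with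
  | add p q hp hq =>
    rw [map_add, hp, hq, ← Matrix.add_mul, ← Matrix.mul_add, Matrix.diagonal_add]
    simp
  | monomial k c =>
    have hpow : (U * Matrix.diagonal ev * U⁻¹) ^ k = U * Matrix.diagonal (ev ^ k) * U⁻¹ := by
      induction k with
      | zero => simp [Matrix.mul_nonsing_inv _ hU']
      | succ k ih =>
        rw [pow_succ, ih]
        calc _ = U * Matrix.diagonal (ev ^ k) * (U⁻¹ * U) * Matrix.diagonal ev * U⁻¹ := by
              simp only [Matrix.mul_assoc]
          _ = _ := by
            rw [Matrix.nonsing_inv_mul _ hU', Matrix.mul_one, Matrix.mul_assoc U,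
              Matrix.diagonal_mul_diagonal]
            rfl
    rw [Polynomial.aeval_monomial, hpow, ← Algebra.smul_def, ← Matrix.smul_mul, ← Matrix.mul_smul,
      ← Matrix.diagonal_smul]
    congr 3
    ext t
    simp

theorem charpoly_conj_diagonal {r : ℕ} {U : Matrix (Fin r) (Fin r) ℂ} (hU : IsUnit U)
    (ev : Fin r → ℂ) : (U * Matrix.diagonal ev * U⁻¹).charpoly =
      ∏ t, (Polynomial.X - Polynomial.C (ev t)) := by
  obtain ⟨u, rfl⟩ := hU
  rw [Matrix.charpoly_units_conj, Matrix.charpoly_diagonal]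

/-- The eigenvalues of `p'(M)` are `p'(ev t) = ∏ (ev t - ev j)` over `j ≠ t`, so `discrDet` is the
discriminant up to sign. It gives a criterion for simple spectrum that is polynomial in the entries.
-/
theorem discrDet_conj_diagonal_ne_zero_iff {r : ℕ} {U : Matrix (Fin r) (Fin r) ℂ} (hU : IsUnit U)
    (ev : Fin r → ℂ) :
    discrDet (U * Matrix.diagonal ev * U⁻¹) ≠ 0 ↔ Function.Injective ev := by
  have hU' : IsUnit U.det := (Matrix.isUnit_iff_isUnit_det _).1 hU
  have hdet : discrDet (U * Matrix.diagonal ev * U⁻¹) =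
      ∏ t, ∏ j ∈ Finset.univ.erase t, (ev t - ev j) := by
    rw [discrDet, charpoly_conj_diagonal hU, aeval_conj_diagonal hU, Matrix.det_mul,
      Matrix.det_mul, mul_right_comm, ← Matrix.det_mul, Matrix.mul_nonsing_inv _ hU',
      Matrix.det_one, one_mul, Matrix.det_diagonal]
    refine Finset.prod_congr rfl fun t _ => ?_
    have h := Lagrange.eval_nodal_derivative_eval_node_eq (v := ev) (Finset.mem_univ t)
    rwa [Lagrange.eval_nodal] at h
  rw [hdet, Finset.prod_ne_zero_iff]
  simp only [Finset.mem_univ, forall_const, Finset.prod_ne_zero_iff, Finset.mem_erase, and_true,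
    sub_ne_zero]
  constructor
  · intro h i j hij
    by_contra hne
    exact h i j (Ne.symm hne) hij
  · intro h i j hji hij
    exact hji (h hij).symm

theorem isUnit_of_eigenvectors {r : ℕ} {M U : Matrix (Fin r) (Fin r) ℂ} {ev : Fin r → ℂ}
    (hev : Function.Injective ev) (hU : ∀ t, U.col t ≠ 0)
    (h : M * U = U * Matrix.diagonal ev) : IsUnit U := by
  rw [← Matrix.linearIndependent_cols_iff_isUnit]
  refine Module.End.eigenvectors_linearIndependent' (Matrix.toLin' M) ev hev U.col fun t => ?_
  refine ⟨Module.End.mem_eigenspace_iff.2 ?_, hU t⟩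
  ext i
  have := congrFun (congrFun h i) t
  rw [Matrix.mul_diagonal] at this
  rw [Matrix.toLin'_apply]
  simpa [Matrix.mul_apply, Matrix.mulVec, dotProduct, mul_comm] using this

theorem eq_conj_of_mul_eq {r : ℕ} {M U D : Matrix (Fin r) (Fin r) ℂ} (hU : IsUnit U)
    (h : M * U = U * D) : M = U * D * U⁻¹ := by
  rw [← h, Matrix.mul_nonsing_inv_cancel_right _ _ ((Matrix.isUnit_iff_isUnit_det _).1 hU)]

theorem exists_eigendecomposition_of_discrDet_ne_zero {r : ℕ} {M : Matrix (Fin r) (Fin r) ℂ}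
    (h : discrDet M ≠ 0) :
    ∃ (U : Matrix (Fin r) (Fin r) ℂ) (ev : Fin r → ℂ),
      IsEigendecomposition M U ev ∧ Function.Injective ev := by
  have hne : M.charpoly ≠ 0 := M.charpoly_monic.ne_zero
  have hvec : ∀ z, M.charpoly.IsRoot z → ∃ v : Fin r → ℂ, v ≠ 0 ∧ M *ᵥ v = z • v := by
    intro z hz
    have := Matrix.mem_spectrum_of_isRoot_charpoly hz
    rw [← Matrix.spectrum_toLin', ← Module.End.hasEigenvalue_iff_mem_spectrum] at this
    obtain ⟨v, hv⟩ := this.exists_hasEigenvector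
    exact ⟨v, hv.2, by simpa using hv.apply_eq_smul⟩
  have hnodup : M.charpoly.roots.Nodup := by
    refine Multiset.nodup_iff_count_le_one.2 fun z => ?_
    rw [Polynomial.count_roots]
    by_contra hlt
    rw [not_le] at hlt
    obtain ⟨hz, hz'⟩ := (Polynomial.one_lt_rootMultiplicity_iff_isRoot hne).1 hlt
    obtain ⟨v, hv, hMv⟩ := hvec z hz
    -- An eigenvector for a double root `z` is killed by `p'(M)`, as `p'(z) = 0`.
    apply h
    rw [discrDet, ← Matrix.exists_mulVec_eq_zero_iff]
    refine ⟨v, hv, ?_⟩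
    have h1 := Module.End.aeval_apply_of_hasEigenvector (f := Matrix.toLin' M)
      (p := M.charpoly.derivative) (μ := z) (x := v)
      ⟨Module.End.mem_eigenspace_iff.2 (by simpa using hMv), hv⟩
    rw [Polynomial.IsRoot.def] at hz'
    rw [hz', zero_smul] at h1
    have h2 : Polynomial.aeval (Matrix.toLin' M) M.charpoly.derivative =
        Matrix.toLin' (Polynomial.aeval M M.charpoly.derivative) :=
      Polynomial.aeval_algHom_apply (Matrix.toLinAlgEquiv' (R := ℂ) (n := Fin r)) M _
    rw [h2] at h1
    simpa using h1
  have hcard : Fintype.card {z // z ∈ M.charpoly.roots.toFinset} = Fintype.card (Fin r) := by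
    rw [Fintype.card_coe, Multiset.toFinset_card_of_nodup hnodup,
      ← (IsAlgClosed.splits M.charpoly).natDegree_eq_card_roots, Matrix.charpoly_natDegree_eq_dim]
  let e := (Fintype.equivOfCardEq hcard).symm
  have hroot : ∀ t, M.charpoly.IsRoot (e t).val := fun t =>
    Polynomial.isRoot_of_mem_roots (Multiset.mem_toFinset.1 (e t).property)
  choose v hv hMv using fun t => hvec _ (hroot t)
  let U : Matrix (Fin r) (Fin r) ℂ := Matrix.of fun i t => v t i
  have hinj : Function.Injective fun t => (e t).val := Subtype.val_injective.comp e.injective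
  have hMU : M * U = U * Matrix.diagonal fun t => (e t).val := by
    ext i t
    rw [Matrix.mul_diagonal]
    have := congrFun (hMv t) i
    simpa [Matrix.mul_apply, Matrix.mulVec, dotProduct, U, mul_comm] using this
  have hU := isUnit_of_eigenvectors hinj (U := U) (fun t => hv t) hMU
  exact ⟨U, _, ⟨hU, eq_conj_of_mul_eq hU hMU⟩, hinj⟩

theorem eq_diagonal_of_commute {r : ℕ} {M : Matrix (Fin r) (Fin r) ℂ} {ev : Fin r → ℂ}
    (hev : Function.Injective ev) (h : M * Matrix.diagonal ev = Matrix.diagonal ev * M) :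
    M = Matrix.diagonal fun t => M t t := by
  ext i j
  rcases eq_or_ne i j with rfl | hij
  · simp
  · have := congrFun (congrFun h i) j
    rw [Matrix.mul_diagonal, Matrix.diagonal_mul, mul_comm] at this
    have h2 : (ev j - ev i) * M i j = 0 := by rw [sub_mul, this, sub_self]
    rcases mul_eq_zero.1 h2 with h3 | h3
    · exact absurd (hev (sub_eq_zero.1 h3)).symm hij
    · rw [h3, Matrix.diagonal_apply_ne _ hij]

/-! ### Position of two eigenbases -/

/-- The determinant of the `r²` matrices `M ^ a * M' ^ b`. -/
def krylovDet {R : Type*} [CommRing R] {r : ℕ} (M M' : Matrix (Fin r) (Fin r) R) : R :=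
  (Matrix.of fun p q : Fin r × Fin r => (M ^ q.1.val * M' ^ q.2.val) p.1 p.2).det

theorem map_krylovDet {R S : Type*} [CommRing R] [CommRing S] {r : ℕ} (f : R →+* S)
    (M M' : Matrix (Fin r) (Fin r) R) :
    f (krylovDet M M') = krylovDet (M.map f) (M'.map f) := by
  rw [krylovDet, krylovDet, RingHom.map_det]
  congr 1
  ext p q
  have h : ∀ (N : Matrix (Fin r) (Fin r) R) (k : ℕ), (N.map f) ^ k = (N ^ k).map f :=
    fun N k => (map_pow f.mapMatrix N k).symm
  simp only [RingHom.mapMatrix_apply, Matrix.map_apply, Matrix.of_apply, h, ← Matrix.map_mul]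

/-- With `W = U⁻¹ V`, the matrix of all `M ^ a * M' ^ b` factors as `(U ⊗ V⁻ᵀ) diag(W i j) (Vand u ⊗
Vand v)`. Thus a condition on eigenvectors becomes polynomial in `M` and `M'`, independent of the
choice and order of the eigenvectors. -/
theorem krylovDet_ne_zero_iff {r : ℕ} {U V : Matrix (Fin r) (Fin r) ℂ} {u v : Fin r → ℂ}
    (hU : IsUnit U) (hV : IsUnit V) (hu : Function.Injective u) (hv : Function.Injective v) :
    krylovDet (U * Matrix.diagonal u * U⁻¹) (V * Matrix.diagonal v * V⁻¹) ≠ 0 ↔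
      ∀ i j, (U⁻¹ * V) i j ≠ 0 := by
  have hU' : IsUnit U.det := (Matrix.isUnit_iff_isUnit_det _).1 hU
  have hV' : IsUnit V.det := (Matrix.isUnit_iff_isUnit_det _).1 hV
  have hpow : ∀ {W : Matrix (Fin r) (Fin r) ℂ} (_ : IsUnit W) (w : Fin r → ℂ) (k : ℕ),
      (W * Matrix.diagonal w * W⁻¹) ^ k = W * Matrix.diagonal (fun t => w t ^ k) * W⁻¹ := by
    intro W hW w k
    simpa using aeval_conj_diagonal hW w (Polynomial.X ^ k)
  have key : (Matrix.of fun p q : Fin r × Fin r =>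
      ((U * Matrix.diagonal u * U⁻¹) ^ q.1.val * (V * Matrix.diagonal v * V⁻¹) ^ q.2.val) p.1 p.2) =
      (U ⊗ₖ (V⁻¹)ᵀ) * Matrix.diagonal (fun p => (U⁻¹ * V) p.1 p.2) *
        (Matrix.vandermonde u ⊗ₖ Matrix.vandermonde v) := by
    ext ⟨i, j⟩ ⟨a, b⟩
    rw [Matrix.of_apply, hpow hU, hpow hV]
    have : U * Matrix.diagonal (fun t => u t ^ a.val) * U⁻¹ *
        (V * Matrix.diagonal (fun t => v t ^ b.val) * V⁻¹) =
        U * (Matrix.diagonal (fun t => u t ^ a.val) * (U⁻¹ * V) *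
          Matrix.diagonal (fun t => v t ^ b.val)) * V⁻¹ := by simp only [Matrix.mul_assoc]
    rw [this, Matrix.mul_apply, Matrix.mul_apply, Fintype.sum_prod_type, Finset.sum_comm]
    refine Finset.sum_congr rfl fun l _ => ?_
    rw [Matrix.mul_apply, Finset.sum_mul]
    refine Finset.sum_congr rfl fun k _ => ?_
    rw [Matrix.mul_diagonal, Matrix.diagonal_mul, Matrix.mul_diagonal]
    simp only [Matrix.kronecker_apply, Matrix.transpose_apply, Matrix.vandermonde_apply]
    ring
  rw [krylovDet, key, Matrix.det_mul, Matrix.det_mul, Matrix.det_kronecker, Matrix.det_kronecker,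
    Matrix.det_diagonal]
  have h1 : (V⁻¹)ᵀ.det ≠ 0 := by
    rw [Matrix.det_transpose]
    exact (Matrix.isUnit_nonsing_inv_det _ hV').ne_zero
  have h2 := Matrix.det_vandermonde_ne_zero_iff.2 hu
  have h3 := Matrix.det_vandermonde_ne_zero_iff.2 hv
  rw [Matrix.det_transpose] at h1
  simp only [ne_eq, mul_eq_zero, pow_eq_zero_iff', Matrix.det_transpose, h1, h2, h3, hU'.ne_zero,
    Finset.prod_eq_zero_iff, false_and, false_or, or_false, Prod.exists, Finset.mem_univ, true_and,
    not_exists]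

/-! ### Roots -/

theorem dthRoot_eq {d : ℕ} (hd : d ≠ 0) (z : ℂ) (k : ℕ) :
    dthRoot d z k = dthRoot d z 0 * Complex.exp (2 * Real.pi * Complex.I / d) ^ k := by
  have hd' : (d : ℂ) ≠ 0 := Nat.cast_ne_zero.2 hd
  rw [dthRoot, dthRoot, ← Complex.exp_nat_mul, mul_assoc (_ : ℂ) (Complex.exp _),
    ← Complex.exp_add]
  congr 2
  push_cast
  field_simp
  ring

theorem norm_mul_exp_angle (z : ℂ) : (‖z‖ : ℂ) * Complex.exp (Complex.I * angle z) = z := by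
  rw [angle]
  split_ifs
  · rw [mul_comm Complex.I, Complex.norm_mul_exp_arg_mul_I]
  · push_cast
    rw [mul_add, Complex.exp_add, mul_comm Complex.I (z.arg : ℂ),
      mul_comm Complex.I (2 * (Real.pi : ℂ)), Complex.exp_two_pi_mul_I, mul_one,
      Complex.norm_mul_exp_arg_mul_I]

theorem dthRoot_pow {d : ℕ} (hd : d ≠ 0) (z : ℂ) (k : ℕ) : dthRoot d z k ^ d = z := by
  have hd' : (d : ℂ) ≠ 0 := Nat.cast_ne_zero.2 hd
  rw [dthRoot_eq hd, mul_pow, ← pow_mul, mul_comm k d, pow_mul,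
    (Complex.isPrimitiveRoot_exp d hd).pow_eq_one, one_pow, mul_one, dthRoot, mul_pow,
    ← Complex.exp_nat_mul, ← Complex.ofReal_pow, one_div, Real.rpow_inv_natCast_pow (norm_nonneg z) hd]
  conv_rhs => rw [← norm_mul_exp_angle z]
  congr 2
  push_cast
  field_simp
  ring

theorem exists_dthRoot_eq {d : ℕ} (hd : d ≠ 0) {z w : ℂ} (hz : z ≠ 0) (hw : w ^ d = z) :
    ∃ k : Fin d, dthRoot d z k.val = w := by
  have h0 : dthRoot d z 0 ≠ 0 := by
    intro h
    have := dthRoot_pow hd z 0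
    rw [h, zero_pow hd] at this
    exact hz this.symm
  have : NeZero d := ⟨hd⟩
  obtain ⟨k, hk, hk'⟩ := (Complex.isPrimitiveRoot_exp d hd).eq_pow_of_pow_eq_one
    (ξ := w / dthRoot d z 0) (by rw [div_pow, hw, dthRoot_pow hd, div_self hz])
  refine ⟨⟨k, hk⟩, ?_⟩
  rw [dthRoot_eq hd, hk', mul_div_cancel₀ _ h0]

/-! ### Moore-Penrose inverses of matrices of full column rank -/

theorem IsMoorePenrose.pinv_eq {l m : Type*} [Fintype l] [Fintype m]
    {A : Matrix l m ℂ} {B : Matrix m l ℂ} (h : IsMoorePenrose A B) : pinv A = B := by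
  have hex : ∃ B, IsMoorePenrose A B := ⟨B, h⟩
  rw [pinv, dif_pos hex]
  exact hex.choose_spec.unique h

theorem isMoorePenrose_mul {l m p : Type*} [Fintype l] [Fintype m] [Fintype p] [DecidableEq p]
    [DecidableEq m] {A : Matrix l p ℂ} (hA : IsUnit (Aᴴ * A)) {C : Matrix p m ℂ}
    {C' : Matrix m p ℂ} (h : C * C' = 1) (h' : C' * C = 1) :
    IsMoorePenrose (A * C) (C' * ((Aᴴ * A)⁻¹ * Aᴴ)) := by
  have hdet := (Matrix.isUnit_iff_isUnit_det _).1 hA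
  have h1 : (Aᴴ * A)⁻¹ * Aᴴ * A = 1 := by rw [Matrix.mul_assoc, Matrix.nonsing_inv_mul _ hdet]
  have hl : A * C * (C' * ((Aᴴ * A)⁻¹ * Aᴴ)) = A * ((Aᴴ * A)⁻¹ * Aᴴ) := by
    rw [Matrix.mul_assoc, ← Matrix.mul_assoc C, h, Matrix.one_mul]
  have hr : C' * ((Aᴴ * A)⁻¹ * Aᴴ) * (A * C) = 1 := by
    rw [Matrix.mul_assoc, ← Matrix.mul_assoc _ A, h1, Matrix.one_mul, h']
  refine ⟨?_, ?_, ?_, ?_⟩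
  · rw [Matrix.mul_assoc, hr, Matrix.mul_one]
  · rw [hr, Matrix.one_mul]
  · rw [hl, Matrix.conjTranspose_mul, Matrix.conjTranspose_mul, Matrix.conjTranspose_nonsing_inv,
      Matrix.conjTranspose_mul, Matrix.conjTranspose_conjTranspose, Matrix.mul_assoc]
  · rw [hr, Matrix.conjTranspose_one]

/-- The reverse order law for `†` fails in general. It holds here because `A` has full column rank,
encoded as invertibility of `Aᴴ * A`, and `C` is invertible. The two index types of `C` differ,
hence the explicit inverse `C'`. -/
theorem pinv_mul {l m p : Type*} [Fintype l] [Fintype m] [Fintype p] [DecidableEq p]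
    [DecidableEq m] {A : Matrix l p ℂ} (hA : IsUnit (Aᴴ * A)) {C : Matrix p m ℂ}
    {C' : Matrix m p ℂ} (h : C * C' = 1) (h' : C' * C = 1) :
    pinv (A * C) = C' * pinv A := by
  have h1 := (isMoorePenrose_mul hA (Matrix.one_mul (1 : Matrix p p ℂ)) (Matrix.one_mul 1)).pinv_eq
  rw [Matrix.mul_one, Matrix.one_mul] at h1
  rw [(isMoorePenrose_mul hA h h').pinv_eq, h1]

theorem pinv_mul_self {l p : Type*} [Fintype l] [Fintype p] [DecidableEq p]
    {A : Matrix l p ℂ} (hA : IsUnit (Aᴴ * A)) : pinv A * A = 1 := by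
  have h1 := (isMoorePenrose_mul hA (Matrix.one_mul (1 : Matrix p p ℂ)) (Matrix.one_mul 1)).pinv_eq
  rw [Matrix.mul_one, Matrix.one_mul] at h1
  rw [h1, Matrix.mul_assoc, Matrix.nonsing_inv_mul _ ((Matrix.isUnit_iff_isUnit_det _).1 hA)]

theorem pinv_eq_of_mul_eq_one {m p : Type*} [Fintype m] [Fintype p] [DecidableEq p]
    [DecidableEq m] {C : Matrix p m ℂ} {C' : Matrix m p ℂ} (h : C * C' = 1) (h' : C' * C = 1) :
    pinv C = C' := by
  refine IsMoorePenrose.pinv_eq ⟨?_, ?_, ?_, ?_⟩ <;> simp [h, h']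

theorem isUnit_conjTranspose_mul_self {l p : Type*} [Fintype l] [Fintype p] [DecidableEq p]
    {A : Matrix l p ℂ} {L : Matrix p l ℂ} (h : L * A = 1) : IsUnit (Aᴴ * A) := by
  have hinj : Function.Injective A.mulVec := by
    intro v w hvw
    have := congrArg (L.mulVec) hvw
    simpa [Matrix.mulVec_mulVec, h] using this
  open ComplexOrder in exact (Matrix.PosDef.conjTranspose_mul_self A hinj).isUnit

/-! ### Unfoldings -/

/-- The columns of `Q_[1]ᵀ` in `Γ`. -/
def squareCols {n r : ℕ} (Q : Core n r) (Γ : Finset (Fin n)) : Matrix (Fin r × Fin r) Γ ℂ :=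
  (unfoldSquare Q)ᵀ.submatrix id (fun c : Γ => c.val)

/-- Gauge transformations of a core act on its unfoldings as Kronecker products; this and
`kronecker_mul_squareCols` translate between the two pictures. -/
theorem unfoldAngle_mul_kronecker {n r : ℕ} (Q : Core n r) (K M : Matrix (Fin r) (Fin r) ℂ) :
    unfoldAngle Q * (K ⊗ₖ M) = unfoldAngle fun a => Kᵀ * Q a * M := by
  ext a ⟨j, k⟩
  simp only [unfoldAngle, Matrix.mul_apply, Matrix.of_apply, Fintype.sum_prod_type,
    Matrix.kronecker_apply, Matrix.transpose_apply, Finset.sum_mul]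
  rw [Finset.sum_comm]
  exact Finset.sum_congr rfl fun _ _ => Finset.sum_congr rfl fun _ _ => by ring

theorem kronecker_mul_squareCols {n r : ℕ} (Q : Core n r) (Γ : Finset (Fin n))
    (K M : Matrix (Fin r) (Fin r) ℂ) :
    (K ⊗ₖ M) * squareCols Q Γ = squareCols (fun a => M * Q a * Kᵀ) Γ := by
  ext ⟨j, k⟩ c
  simp only [squareCols, unfoldSquare, Matrix.mul_apply, Matrix.of_apply, Fintype.sum_prod_type,
    Matrix.kronecker_apply, Matrix.transpose_apply, Finset.sum_mul, Matrix.submatrix_apply, id]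
  exact Finset.sum_congr rfl fun _ _ => Finset.sum_congr rfl fun _ _ => by ring

/-- All slices are invertible, and so are all maximal minors of the unfolding. -/
structure IsRegular {n r : ℕ} (Q : Core n r) : Prop where
  isUnit_slice : ∀ a, IsUnit (Q a)
  squareCols_inv : ∀ Γ : Finset (Fin n), Γ.card = r ^ 2 →
    ∃ C : Matrix Γ (Fin r × Fin r) ℂ, squareCols Q Γ * C = 1 ∧ C * squareCols Q Γ = 1

theorem IsRegular.isUnit_unfoldAngle {n r : ℕ} {Q : Core n r} (hQ : IsRegular Q)
    (hn : r ^ 2 ≤ n) : IsUnit ((unfoldAngle Q)ᴴ * unfoldAngle Q) := by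
  obtain ⟨Γ, -, hΓ⟩ := Finset.exists_subset_card_eq (s := (Finset.univ : Finset (Fin n)))
    (n := r ^ 2) (by simpa using hn)
  obtain ⟨C, hC, -⟩ := hQ.squareCols_inv Γ hΓ
  -- A left inverse of the whole unfolding: the inverse of the minor in `Γ`, padded by zeros. The
  -- swap accounts for the opposite column orders of the two unfoldings.
  refine isUnit_conjTranspose_mul_self (L := Matrix.of fun q a =>
    if h : a ∈ Γ then C ⟨a, h⟩ q.swap else 0) ?_
  ext q p
  have h := congrFun (congrFun hC p.swap) q.swap
  rw [Matrix.mul_apply] at h ⊢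
  simp only [Matrix.of_apply]
  rw [← Finset.sum_subset (Finset.subset_univ Γ) fun a _ ha => by rw [dif_neg ha, zero_mul],
    ← Finset.sum_coe_sort]
  have h1 : (1 : Matrix (Fin r × Fin r) (Fin r × Fin r) ℂ) q p =
      (1 : Matrix (Fin r × Fin r) (Fin r × Fin r) ℂ) p.swap q.swap := by
    simp only [Matrix.one_apply, Prod.swap_inj, eq_comm]
  rw [h1, ← h]
  refine Finset.sum_congr rfl fun c _ => ?_
  rw [dif_pos c.property, mul_comm]
  rfl

theorem symTensor_fullIndex {n r d : ℕ} (hd : 2 ≤ d) (Q : Core n r) (a c : Fin n)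
    (α : Fin (d - 2) → Fin n) :
    symTensor d Q (fullIndex a α c) = (Q a * Sampling.midProd Q α * Q c).trace := by
  obtain ⟨e, rfl⟩ : ∃ e, d = e + 2 := ⟨d - 2, by omega⟩
  rw [symTensor, List.ofFn_succ, List.ofFn_succ', List.prod_cons, List.concat_eq_append,
    List.prod_append, List.prod_singleton, ← Matrix.mul_assoc, Sampling.midProd]
  congr 3
  · congr 2
    ext1 k
    have hk : k.val ≠ e := k.isLt.ne
    simp [fullIndex, hk]
  · simp [fullIndex]

/-- The trace is the pairing of the entries of `Q a` with those of the transpose of `R * Q c`. This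
yields the factorization of every observed matrix. -/
theorem trace_eq_unfold {n r : ℕ} (Q : Core n r) (R : Matrix (Fin r) (Fin r) ℂ)
    (Γ : Finset (Fin n)) (a : Fin n) (c : Γ) :
    (Q a * R * Q c.val).trace =
      (unfoldAngle Q * (((1 : Matrix (Fin r) (Fin r) ℂ) ⊗ₖ R) * squareCols Q Γ)) a c := by
  rw [kronecker_mul_squareCols, Matrix.mul_assoc, Matrix.trace, Matrix.mul_apply,
    Fintype.sum_prod_type]
  refine Finset.sum_congr rfl fun i _ => ?_
  rw [Matrix.diag_apply, Matrix.mul_apply]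
  refine Finset.sum_congr rfl fun j _ => ?_
  simp [unfoldAngle, squareCols, unfoldSquare]

theorem Sampling.slice_observe {n r d : ℕ} (hd : 2 ≤ d) (Q : Core n r) (s : Sampling n d r)
    (α : Fin (d - 2) → Fin n) (Γ : Finset (Fin n)) (h : block d α Γ ⊆ s.positions) :
    s.slice (s.observe (symTensor d Q)) α Γ h =
      unfoldAngle Q * (((1 : Matrix (Fin r) (Fin r) ℂ) ⊗ₖ midProd Q α) * squareCols Q Γ) := by
  ext a c
  rw [← trace_eq_unfold, ← symTensor_fullIndex hd]
  rfl

theorem isUnit_prod_ofFn {n r l : ℕ} {Q : Core n r} (hQ : ∀ a, IsUnit (Q a))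
    (α : Fin l → Fin n) :
    IsUnit (List.ofFn fun k => Q (α k)).prod := by
  refine List.prod_isUnit fun M hM => ?_
  obtain ⟨k, rfl⟩ := List.mem_ofFn.1 hM
  exact hQ _

/-- Both slices have the same columns `Γ`, so the invertible factor `squareCols Q Γ` cancels. -/
theorem mul_pinv_of_unfold {n r : ℕ} {Q : Core n r}
    (hA : IsUnit ((unfoldAngle Q)ᴴ * unfoldAngle Q)) {Γ : Finset (Fin n)}
    {C : Matrix Γ (Fin r × Fin r) ℂ} (hC : squareCols Q Γ * C = 1) (hC' : C * squareCols Q Γ = 1)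
    (R R' : Matrix (Fin r) (Fin r) ℂ) (hR' : IsUnit R') :
    unfoldAngle Q * (((1 : Matrix (Fin r) (Fin r) ℂ) ⊗ₖ R) * squareCols Q Γ) *
      pinv (unfoldAngle Q * (((1 : Matrix (Fin r) (Fin r) ℂ) ⊗ₖ R') * squareCols Q Γ)) =
    unfoldAngle Q * ((1 : Matrix (Fin r) (Fin r) ℂ) ⊗ₖ (R * R'⁻¹)) * pinv (unfoldAngle Q) := by
  have hR := (Matrix.isUnit_iff_isUnit_det _).1 hR'
  have e1 : ((1 : Matrix (Fin r) (Fin r) ℂ) ⊗ₖ R') * ((1 : Matrix (Fin r) (Fin r) ℂ) ⊗ₖ R'⁻¹) = 1 := by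
    rw [← Matrix.mul_kronecker_mul, Matrix.mul_nonsing_inv _ hR, Matrix.one_mul,
      Matrix.one_kronecker_one]
  have e2 : ((1 : Matrix (Fin r) (Fin r) ℂ) ⊗ₖ R'⁻¹) * ((1 : Matrix (Fin r) (Fin r) ℂ) ⊗ₖ R') = 1 := by
    rw [← Matrix.mul_kronecker_mul, Matrix.nonsing_inv_mul _ hR, Matrix.one_mul,
      Matrix.one_kronecker_one]
  rw [pinv_mul hA (C' := C * ((1 : Matrix (Fin r) (Fin r) ℂ) ⊗ₖ R'⁻¹))]
  · have e3 : (1 : Matrix (Fin r) (Fin r) ℂ) ⊗ₖ (R * R'⁻¹) =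
        ((1 : Matrix (Fin r) (Fin r) ℂ) ⊗ₖ R) * ((1 : Matrix (Fin r) (Fin r) ℂ) ⊗ₖ R'⁻¹) := by
      rw [← Matrix.mul_kronecker_mul, Matrix.one_mul]
    rw [e3]
    simp only [Matrix.mul_assoc]
    rw [← Matrix.mul_assoc (squareCols Q Γ), hC, Matrix.one_mul]
  · rw [Matrix.mul_assoc, ← Matrix.mul_assoc (squareCols Q Γ), hC, Matrix.one_mul, e1]
  · rw [Matrix.mul_assoc, ← Matrix.mul_assoc _ _ (squareCols Q Γ), e2, Matrix.one_mul, hC']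

/-! ### Spectral probes -/

theorem isUnit_blockDiagonal_iff {r : ℕ} (K : Fin r → Matrix (Fin r) (Fin r) ℂ) :
    IsUnit (Matrix.blockDiagonal K) ↔ ∀ t, IsUnit (K t) := by
  simp only [Matrix.isUnit_iff_isUnit_det, Matrix.det_blockDiagonal, isUnit_iff_ne_zero,
    Finset.prod_ne_zero_iff, Finset.mem_univ, forall_const]

/-- The eigenvectors of `1 ⊗ S` are the pure tensors `k ⊗ u` with an eigenvector `u` of `S`. -/
theorem exists_eigenvectors_kronecker {r : ℕ} {S : Matrix (Fin r) (Fin r) ℂ}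
    {X : Matrix (Fin r × Fin r) (Fin r × Fin r) ℂ} (hX : IsUnit X) {ev : Fin r → ℂ}
    (hev : Function.Injective ev)
    (h : ((1 : Matrix (Fin r) (Fin r) ℂ) ⊗ₖ S) * X = X * Matrix.diagonal fun p : Fin r × Fin r => ev p.2) :
    ∃ (U : Matrix (Fin r) (Fin r) ℂ) (K : Fin r → Matrix (Fin r) (Fin r) ℂ),
      IsEigendecomposition S U ev ∧ (∀ t, IsUnit (K t)) ∧
      X = ((1 : Matrix (Fin r) (Fin r) ℂ) ⊗ₖ U) * Matrix.blockDiagonal K := by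
  have hent : ∀ (j k : Fin r) (q : Fin r × Fin r),
      ∑ l, S k l * X (j, l) q = ev q.2 * X (j, k) q := by
    intro j k q
    have := congrFun (congrFun h (j, k)) q
    rw [Matrix.mul_diagonal, Matrix.mul_apply, Fintype.sum_prod_type] at this
    simpa [Matrix.one_apply, mul_comm] using this
  -- Any column of `X` belonging to the eigenvalue `ev t` would do; `(t, t)` is one. Its nonzero
  -- segment along the second index is an eigenvector of `S`.
  have hcol : ∀ t : Fin r, ∃ j k, X (j, k) (t, t) ≠ 0 := by
    intro t
    by_contra! hzero
    have hdet := (Matrix.isUnit_iff_isUnit_det _).1 hX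
    rw [Matrix.det_eq_zero_of_column_eq_zero (t, t) fun p => hzero p.1 p.2] at hdet
    exact not_isUnit_zero hdet
  choose f g hfg using hcol
  let U : Matrix (Fin r) (Fin r) ℂ := Matrix.of fun k t => X (f t, k) (t, t)
  have hSU : S * U = U * Matrix.diagonal ev := by
    ext k t
    rw [Matrix.mul_diagonal, Matrix.mul_apply, mul_comm]
    exact hent (f t) k (t, t)
  have hU : IsUnit U := isUnit_of_eigenvectors hev
    (fun t h0 => hfg t (congrFun h0 (g t))) hSU
  have hU' := (Matrix.isUnit_iff_isUnit_det _).1 hU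
  have e1 : ((1 : Matrix (Fin r) (Fin r) ℂ) ⊗ₖ U) * ((1 : Matrix (Fin r) (Fin r) ℂ) ⊗ₖ U⁻¹) = 1 := by
    rw [← Matrix.mul_kronecker_mul, Matrix.mul_nonsing_inv _ hU', Matrix.one_mul,
      Matrix.one_kronecker_one]
  have e2 : ((1 : Matrix (Fin r) (Fin r) ℂ) ⊗ₖ U⁻¹) * ((1 : Matrix (Fin r) (Fin r) ℂ) ⊗ₖ U) = 1 := by
    rw [← Matrix.mul_kronecker_mul, Matrix.nonsing_inv_mul _ hU', Matrix.one_mul,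
      Matrix.one_kronecker_one]
  let Z := ((1 : Matrix (Fin r) (Fin r) ℂ) ⊗ₖ U⁻¹) * X
  have hZ : Matrix.diagonal (fun p : Fin r × Fin r => ev p.2) * Z =
      Z * Matrix.diagonal fun p : Fin r × Fin r => ev p.2 := by
    have hd : Matrix.diagonal (fun p : Fin r × Fin r => ev p.2) =
        (1 : Matrix (Fin r) (Fin r) ℂ) ⊗ₖ Matrix.diagonal ev := by
      rw [← Matrix.diagonal_one, Matrix.diagonal_kronecker_diagonal]
      simp
    have hinv : Matrix.diagonal ev * U⁻¹ = U⁻¹ * S := by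
      rw [eq_conj_of_mul_eq hU hSU, Matrix.mul_assoc, Matrix.nonsing_inv_mul_cancel_left _ _ hU']
    rw [Matrix.mul_assoc, ← h, ← Matrix.mul_assoc, ← Matrix.mul_assoc, hd,
      ← Matrix.mul_kronecker_mul, ← Matrix.mul_kronecker_mul, hinv]
  -- `Z` commutes with a diagonal matrix whose entries separate the values of the second index, so
  -- it is block diagonal in that index.
  have hZb : Z = Matrix.blockDiagonal fun t => Matrix.of fun j k => Z (j, t) (k, t) := by
    ext ⟨j, t⟩ ⟨k, t'⟩
    rw [Matrix.blockDiagonal_apply']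
    split_ifs with htt
    · subst htt; rfl
    · have := congrFun (congrFun hZ (j, t)) (k, t')
      rw [Matrix.mul_diagonal, Matrix.diagonal_mul, mul_comm] at this
      rcases mul_eq_mul_left_iff.1 this with h1 | h1
      · exact absurd (hev h1) htt
      · exact h1
  have hXZ : X = ((1 : Matrix (Fin r) (Fin r) ℂ) ⊗ₖ U) * Z := by
    rw [← Matrix.mul_assoc, e1, Matrix.one_mul]
  refine ⟨U, fun t => Matrix.of fun j k => Z (j, t) (k, t), ⟨hU, eq_conj_of_mul_eq hU hSU⟩,
    ?_, by rw [← hZb]; exact hXZ⟩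
  rw [← isUnit_blockDiagonal_iff, ← hZb]
  exact (IsUnit.of_mul_eq_one _ e2).mul hX

theorem isEigenbasis_iff {n r : ℕ} {M : Matrix (Fin n) (Fin n) ℂ}
    {E : Matrix (Fin n) (Fin r × Fin r) ℂ} :
    IsEigenbasis M E ↔ ∃ ev : Fin r → ℂ, Function.Injective ev ∧ (∀ t, ev t ≠ 0) ∧
      LinearIndependent ℂ E.col ∧
      M * E = E * Matrix.diagonal fun p : Fin r × Fin r => ev p.2 :=
  Iff.rfl

theorem IsEigenbasis.exists_factorization {n r : ℕ} {A E : Matrix (Fin n) (Fin r × Fin r) ℂ}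
    (hA : IsUnit (Aᴴ * A)) {S : Matrix (Fin r) (Fin r) ℂ}
    (h : IsEigenbasis (A * ((1 : Matrix (Fin r) (Fin r) ℂ) ⊗ₖ S) * pinv A) E) :
    ∃ (U : Matrix (Fin r) (Fin r) ℂ) (K : Fin r → Matrix (Fin r) (Fin r) ℂ) (ev : Fin r → ℂ),
      Function.Injective ev ∧ IsEigendecomposition S U ev ∧ (∀ t, IsUnit (K t)) ∧
      E = A * (((1 : Matrix (Fin r) (Fin r) ℂ) ⊗ₖ U) * Matrix.blockDiagonal K) := by
  obtain ⟨ev, hinj, hne, hlin, hE⟩ := isEigenbasis_iff.1 h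
  -- Since the eigenvalues are nonzero, `E = M E diag(ev)⁻¹` lies in the range of `A`; `X` holds its
  -- coordinates.
  let X := ((1 : Matrix (Fin r) (Fin r) ℂ) ⊗ₖ S) * pinv A * E *
    Matrix.diagonal fun p : Fin r × Fin r => (ev p.2)⁻¹
  have hdd : (Matrix.diagonal fun p : Fin r × Fin r => ev p.2) *
      (Matrix.diagonal fun p : Fin r × Fin r => (ev p.2)⁻¹) = 1 := by
    rw [Matrix.diagonal_mul_diagonal, ← Matrix.diagonal_one]
    congr 1
    ext p
    exact mul_inv_cancel₀ (hne p.2)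
  have hEX : E = A * X := by
    calc E = E * ((Matrix.diagonal fun p : Fin r × Fin r => ev p.2) *
      (Matrix.diagonal fun p : Fin r × Fin r => (ev p.2)⁻¹)) := by rw [hdd, Matrix.mul_one]
      _ = A * X := by rw [← Matrix.mul_assoc, ← hE]; simp only [X, Matrix.mul_assoc]
  have hX : IsUnit X := by
    rw [← Matrix.mulVec_injective_iff_isUnit]
    have hEinj := Matrix.mulVec_injective_iff.2 hlin
    intro v w hvw
    apply hEinj
    rw [hEX, ← Matrix.mulVec_mulVec v A X, ← Matrix.mulVec_mulVec w A X]
    exact congrArg _ hvw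
  have hXE : pinv A * E = X := by
    rw [hEX, ← Matrix.mul_assoc, pinv_mul_self hA, Matrix.one_mul]
  obtain ⟨U, K, hU, hK, hXU⟩ := exists_eigenvectors_kronecker (S := S) hX hinj (by
    have := congrArg (pinv A * ·) hE
    simp only [← Matrix.mul_assoc, pinv_mul_self hA, Matrix.one_mul] at this
    rw [Matrix.mul_assoc, hXE] at this
    exact this)
  exact ⟨U, K, ev, hinj, hU, hK, by rw [← hXU]; exact hEX⟩

theorem isEigenbasis_of_eigendecomposition {n r : ℕ} {A : Matrix (Fin n) (Fin r × Fin r) ℂ}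
    (hA : IsUnit (Aᴴ * A)) {S U : Matrix (Fin r) (Fin r) ℂ} {ev : Fin r → ℂ}
    (h : IsEigendecomposition S U ev) (hinj : Function.Injective ev) (hne : ∀ t, ev t ≠ 0) :
    IsEigenbasis (A * ((1 : Matrix (Fin r) (Fin r) ℂ) ⊗ₖ S) * pinv A)
      (A * ((1 : Matrix (Fin r) (Fin r) ℂ) ⊗ₖ U)) := by
  obtain ⟨hU, hS⟩ := h
  have hU' := (Matrix.isUnit_iff_isUnit_det _).1 hU
  refine isEigenbasis_iff.2 ⟨ev, hinj, hne, ?_, ?_⟩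
  · rw [← Matrix.mulVec_injective_iff]
    intro v w hvw
    have e2 : ((1 : Matrix (Fin r) (Fin r) ℂ) ⊗ₖ U⁻¹) *
        ((1 : Matrix (Fin r) (Fin r) ℂ) ⊗ₖ U) = 1 := by
      rw [← Matrix.mul_kronecker_mul, Matrix.nonsing_inv_mul _ hU', Matrix.one_mul,
        Matrix.one_kronecker_one]
    have := congrArg (((1 : Matrix (Fin r) (Fin r) ℂ) ⊗ₖ U⁻¹) * pinv A).mulVec hvw
    rw [Matrix.mulVec_mulVec, Matrix.mulVec_mulVec, Matrix.mul_assoc, ← Matrix.mul_assoc (pinv A),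
      pinv_mul_self hA, Matrix.one_mul, e2, Matrix.one_mulVec, Matrix.one_mulVec] at this
    exact this
  · have hd : Matrix.diagonal (fun p : Fin r × Fin r => ev p.2) =
        (1 : Matrix (Fin r) (Fin r) ℂ) ⊗ₖ Matrix.diagonal ev := by
      rw [← Matrix.diagonal_one, Matrix.diagonal_kronecker_diagonal]
      simp
    rw [Matrix.mul_assoc, ← Matrix.mul_assoc (pinv A), pinv_mul_self hA, Matrix.one_mul,
      Matrix.mul_assoc, Matrix.mul_assoc, hd, ← Matrix.mul_kronecker_mul,
      ← Matrix.mul_kronecker_mul, hS, Matrix.nonsing_inv_mul_cancel_right _ _ hU',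
      Matrix.one_mul]

theorem blockDiagonal_mul_one_kronecker_apply {r : ℕ} (K : Fin r → Matrix (Fin r) (Fin r) ℂ)
    (W : Matrix (Fin r) (Fin r) ℂ) (a j c k : Fin r) :
    (Matrix.blockDiagonal K * ((1 : Matrix (Fin r) (Fin r) ℂ) ⊗ₖ W)) (a, j) (c, k) =
      W j k * K j a c := by
  rw [Matrix.mul_apply, Finset.sum_eq_single (c, j)]
  · simp [mul_comm]
  · rintro ⟨x, y⟩ - hxy
    rw [Matrix.blockDiagonal_apply', Matrix.kronecker_apply, Matrix.one_apply]
    split_ifs with h1 h2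
    · exact absurd (by rw [h1, h2]) hxy
    all_goals simp
  · simp

/-- Here `pinv E * E' = Π(K)⁻¹ (1 ⊗ U⁻¹ V) Π(K')`: the unknown `A` cancels between the two probes.
-/
theorem probeBlock_eq {n r : ℕ} {A E E' : Matrix (Fin n) (Fin r × Fin r) ℂ}
    (hA : IsUnit (Aᴴ * A)) {U V : Matrix (Fin r) (Fin r) ℂ}
    {K K' : Fin r → Matrix (Fin r) (Fin r) ℂ} (hU : IsUnit U) (hK : ∀ t, IsUnit (K t))
    (hE : E = A * (((1 : Matrix (Fin r) (Fin r) ℂ) ⊗ₖ U) * Matrix.blockDiagonal K))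
    (hE' : E' = A * (((1 : Matrix (Fin r) (Fin r) ℂ) ⊗ₖ V) * Matrix.blockDiagonal K'))
    (j k : Fin r) : probeBlock E E' j k = (U⁻¹ * V) j k • ((K j)⁻¹ * K' k) := by
  have hU' := (Matrix.isUnit_iff_isUnit_det _).1 hU
  have hK' := fun t => (Matrix.isUnit_iff_isUnit_det _).1 (hK t)
  have e1 : ((1 : Matrix (Fin r) (Fin r) ℂ) ⊗ₖ U) * ((1 : Matrix (Fin r) (Fin r) ℂ) ⊗ₖ U⁻¹) = 1 := by
    rw [← Matrix.mul_kronecker_mul, Matrix.mul_nonsing_inv _ hU', Matrix.one_mul,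
      Matrix.one_kronecker_one]
  have e2 : ((1 : Matrix (Fin r) (Fin r) ℂ) ⊗ₖ U⁻¹) * ((1 : Matrix (Fin r) (Fin r) ℂ) ⊗ₖ U) = 1 := by
    rw [← Matrix.mul_kronecker_mul, Matrix.nonsing_inv_mul _ hU', Matrix.one_mul,
      Matrix.one_kronecker_one]
  have k1 : Matrix.blockDiagonal K * Matrix.blockDiagonal (fun t => (K t)⁻¹) = 1 := by
    rw [← Matrix.blockDiagonal_mul, ← Matrix.blockDiagonal_one]
    congr 1
    ext1 t
    exact Matrix.mul_nonsing_inv _ (hK' t)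
  have k2 : Matrix.blockDiagonal (fun t => (K t)⁻¹) * Matrix.blockDiagonal K = 1 := by
    rw [← Matrix.blockDiagonal_mul, ← Matrix.blockDiagonal_one]
    congr 1
    ext1 t
    exact Matrix.nonsing_inv_mul _ (hK' t)
  have hF : pinv E * E' = Matrix.blockDiagonal (fun t => (K t)⁻¹) *
      ((1 : Matrix (Fin r) (Fin r) ℂ) ⊗ₖ (U⁻¹ * V)) * Matrix.blockDiagonal K' := by
    rw [hE, pinv_mul hA (C' := Matrix.blockDiagonal (fun t => (K t)⁻¹) *
      ((1 : Matrix (Fin r) (Fin r) ℂ) ⊗ₖ U⁻¹)), hE', ← Matrix.mul_assoc _ A,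
      Matrix.mul_assoc _ (pinv A), pinv_mul_self hA, Matrix.mul_one, Matrix.mul_assoc,
      ← Matrix.mul_assoc _ _ (Matrix.blockDiagonal K'), ← Matrix.mul_kronecker_mul, Matrix.one_mul,
      ← Matrix.mul_assoc]
    · rw [Matrix.mul_assoc, ← Matrix.mul_assoc _ _ ((1 : Matrix (Fin r) (Fin r) ℂ) ⊗ₖ U⁻¹), k1,
        Matrix.one_mul, e1]
    · rw [Matrix.mul_assoc, ← Matrix.mul_assoc _ _ (Matrix.blockDiagonal K), e2, Matrix.one_mul, k2]
  ext a b
  rw [probeBlock, Matrix.of_apply, hF, Matrix.smul_apply, Matrix.mul_apply, Matrix.mul_apply (M := (K j)⁻¹),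
    Fintype.sum_prod_type, smul_eq_mul, Finset.mul_sum]
  refine Finset.sum_congr rfl fun c _ => ?_
  simp only [blockDiagonal_mul_one_kronecker_apply, Matrix.blockDiagonal_apply', mul_ite, mul_zero,
    Finset.sum_ite_eq', Finset.mem_univ, if_true]
  ring

/-- The unknown `K' 0` of the second probe cancels in the quotient of two blocks of the same block
column. -/
theorem gaugeBlock_eq {n r : ℕ} [NeZero r] {A E E' : Matrix (Fin n) (Fin r × Fin r) ℂ}
    (hA : IsUnit (Aᴴ * A)) {U V : Matrix (Fin r) (Fin r) ℂ}
    {K K' : Fin r → Matrix (Fin r) (Fin r) ℂ} (hU : IsUnit U) (hK : ∀ t, IsUnit (K t))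
    (hK' : ∀ t, IsUnit (K' t))
    (hE : E = A * (((1 : Matrix (Fin r) (Fin r) ℂ) ⊗ₖ U) * Matrix.blockDiagonal K))
    (hE' : E' = A * (((1 : Matrix (Fin r) (Fin r) ℂ) ⊗ₖ V) * Matrix.blockDiagonal K'))
    (hW : ∀ t, (U⁻¹ * V) t 0 ≠ 0) (t : Fin r) :
    gaugeBlock E E' t = ((U⁻¹ * V) 0 0 / (U⁻¹ * V) t 0) • ((K 0)⁻¹ * K t) := by
  have hdet := fun t => (Matrix.isUnit_iff_isUnit_det _).1 (hK t)
  rw [gaugeBlock]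
  split_ifs with ht
  · rw [ht, div_self (hW 0), one_smul, Matrix.nonsing_inv_mul _ (hdet 0)]
  · rw [probeBlock_eq hA hU hK hE hE', probeBlock_eq hA hU hK hE hE']
    have hY : IsUnit ((U⁻¹ * V) t 0 • ((K t)⁻¹ * K' 0)) := by
      have := ((Matrix.isUnit_nonsing_inv_iff.2 (hK t)).mul (hK' 0)).smul (Units.mk0 _ (hW t))
      exact this
    have hX : (U⁻¹ * V) 0 0 • ((K 0)⁻¹ * K' 0) =
        (((U⁻¹ * V) 0 0 / (U⁻¹ * V) t 0) • ((K 0)⁻¹ * K t)) *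
          ((U⁻¹ * V) t 0 • ((K t)⁻¹ * K' 0)) := by
      rw [Matrix.smul_mul, Matrix.mul_smul, smul_smul, div_mul_cancel₀ _ (hW t), Matrix.mul_assoc,
        ← Matrix.mul_assoc (K t), Matrix.mul_nonsing_inv _ (hdet t), Matrix.one_mul]
    rw [hX, Matrix.mul_nonsing_inv_cancel_right _ _ ((Matrix.isUnit_iff_isUnit_det _).1 hY)]

/-- With `D` the diagonal matrix of the ratios, `Π(K) = (K 0 ⊗ D) Π(K̂)`. Dividing `E` by `Π(K̂)`
leaves `A (K 0 ⊗ U D)`, a gauge transform of `Q`: the scalar ambiguities of the gauge blocks are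
absorbed into `D`. -/
theorem firstCore_eq {n r : ℕ} [NeZero r] {Q : Core n r} {E E' : Matrix (Fin n) (Fin r × Fin r) ℂ}
    (hA : IsUnit ((unfoldAngle Q)ᴴ * unfoldAngle Q)) {U V : Matrix (Fin r) (Fin r) ℂ}
    {K K' : Fin r → Matrix (Fin r) (Fin r) ℂ} (hU : IsUnit U) (hK : ∀ t, IsUnit (K t))
    (hK' : ∀ t, IsUnit (K' t))
    (hE : E = unfoldAngle Q * (((1 : Matrix (Fin r) (Fin r) ℂ) ⊗ₖ U) * Matrix.blockDiagonal K))
    (hE' : E' = unfoldAngle Q * (((1 : Matrix (Fin r) (Fin r) ℂ) ⊗ₖ V) * Matrix.blockDiagonal K'))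
    (hW : ∀ t, (U⁻¹ * V) t 0 ≠ 0) (a : Fin n) :
    firstCore E E' a = (K 0)ᵀ * Q a *
      (U * Matrix.diagonal fun t => (U⁻¹ * V) t 0 / (U⁻¹ * V) 0 0) := by
  have hdet := fun t => (Matrix.isUnit_iff_isUnit_det _).1 (hK t)
  have hg := gaugeBlock_eq hA hU hK hK' hE hE' hW
  have hgu : IsUnit (Matrix.blockDiagonal (gaugeBlock E E')) := by
    rw [isUnit_blockDiagonal_iff]
    intro t
    rw [hg]
    exact ((Matrix.isUnit_nonsing_inv_iff.2 (hK 0)).mul (hK t)).smul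
      (Units.mk0 _ (div_ne_zero (hW 0) (hW t)))
  set D : Matrix (Fin r) (Fin r) ℂ :=
    Matrix.diagonal fun t => (U⁻¹ * V) t 0 / (U⁻¹ * V) 0 0 with hD
  have hKD : Matrix.blockDiagonal K = (K 0 ⊗ₖ D) * Matrix.blockDiagonal (gaugeBlock E E') := by
    have h1 : K 0 ⊗ₖ D = Matrix.blockDiagonal fun t =>
        ((U⁻¹ * V) t 0 / (U⁻¹ * V) 0 0) • K 0 := by
      ext ⟨i, t⟩ ⟨j, t'⟩
      rw [Matrix.kronecker_apply, Matrix.blockDiagonal_apply', hD, Matrix.diagonal_apply]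
      split_ifs <;> simp [mul_comm]
    rw [h1, ← Matrix.blockDiagonal_mul]
    congr 1
    ext1 t
    rw [hg, Matrix.smul_mul, Matrix.mul_smul, smul_smul, div_mul_div_comm, mul_comm (_ : ℂ),
      div_self (mul_ne_zero (hW 0) (hW t)), one_smul, Matrix.mul_nonsing_inv_cancel_left _ _ (hdet 0)]
  have hE2 : E * (Matrix.blockDiagonal (gaugeBlock E E'))⁻¹ =
      unfoldAngle fun a => (K 0)ᵀ * Q a * (U * D) := by
    rw [← unfoldAngle_mul_kronecker]
    conv_lhs => enter [1]; rw [hE, hKD]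
    rw [← Matrix.mul_assoc, ← Matrix.mul_assoc,
      Matrix.mul_nonsing_inv_cancel_right _ _ ((Matrix.isUnit_iff_isUnit_det _).1 hgu),
      Matrix.mul_assoc, ← Matrix.mul_kronecker_mul, Matrix.one_mul]
  rw [firstCore, hE2]
  rfl

/-- The block `(0, 0)` is not among those required to be invertible. If it vanishes and `r ≥ 2`,
some gauge block is zero, so `Π(K̂)` is singular and its `⁻¹` has the default value `0`. -/
theorem firstCore_eq_zero {n r : ℕ} [NeZero r] {E E' : Matrix (Fin n) (Fin r × Fin r) ℂ}
    (hr : 2 ≤ r) (h : probeBlock E E' 0 0 = 0) : firstCore E E' = 0 := by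
  have h1 : ¬ IsUnit (Matrix.blockDiagonal (gaugeBlock E E')) := by
    rw [isUnit_blockDiagonal_iff]
    push Not
    have h01 : (⟨1, by omega⟩ : Fin r) ≠ 0 := by simp [Fin.ext_iff]
    refine ⟨⟨1, by omega⟩, ?_⟩
    have : Nonempty (Fin r) := ⟨0⟩
    rw [gaugeBlock, if_neg h01, h, Matrix.zero_mul]
    exact not_isUnit_zero
  rw [Matrix.isUnit_iff_isUnit_det] at h1
  rw [firstCore, Matrix.nonsing_inv_apply_not_isUnit _ h1, Matrix.mul_zero]
  rfl

/-! ### The loop over the cores -/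

/-- The matrix inverted in the loop is `(Hᵀ ⊗ X) S`, so `S` cancels against the same factor of the
observed matrix. The left gauge of the new core is the right gauge `H` of the old one. -/
theorem nextCore_eq {n r : ℕ} {Q C : Core n r} {Γ : Finset (Fin n)}
    {B : Matrix Γ (Fin r × Fin r) ℂ} (hB : squareCols Q Γ * B = 1) (hB' : B * squareCols Q Γ = 1)
    {P X Y H : Matrix (Fin r) (Fin r) ℂ} (hX : IsUnit X) (hH : IsUnit H)
    (hC : ∀ a, P * C a = X * Q a * H) (a : Fin n) :
    nextCore (unfoldAngle Q * (((1 : Matrix (Fin r) (Fin r) ℂ) ⊗ₖ Y) * squareCols Q Γ)) P C a =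
      H⁻¹ * Q a * (Y * X⁻¹) := by
  have hX' := (Matrix.isUnit_iff_isUnit_det _).1 hX
  have hH' : IsUnit (Hᵀ).det := by
    rw [Matrix.det_transpose]; exact (Matrix.isUnit_iff_isUnit_det _).1 hH
  have h1 : ((1 : Matrix (Fin r) (Fin r) ℂ) ⊗ₖ P) *
      (unfoldSquare C)ᵀ.submatrix id (fun c : Γ => c.val) = (Hᵀ ⊗ₖ X) * squareCols Q Γ := by
    rw [kronecker_mul_squareCols, Matrix.transpose_transpose]
    refine (kronecker_mul_squareCols C Γ 1 P).trans ?_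
    simp only [hC, Matrix.transpose_one, Matrix.mul_one]
  have e1 : (Hᵀ ⊗ₖ X) * ((Hᵀ)⁻¹ ⊗ₖ X⁻¹) = 1 := by
    rw [← Matrix.mul_kronecker_mul, Matrix.mul_nonsing_inv _ hH', Matrix.mul_nonsing_inv _ hX',
      Matrix.one_kronecker_one]
  have e2 : ((Hᵀ)⁻¹ ⊗ₖ X⁻¹) * (Hᵀ ⊗ₖ X) = 1 := by
    rw [← Matrix.mul_kronecker_mul, Matrix.nonsing_inv_mul _ hH', Matrix.nonsing_inv_mul _ hX',
      Matrix.one_kronecker_one]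
  have h2 : pinv ((Hᵀ ⊗ₖ X) * squareCols Q Γ) = B * ((Hᵀ)⁻¹ ⊗ₖ X⁻¹) := by
    apply pinv_eq_of_mul_eq_one
    · rw [Matrix.mul_assoc, ← Matrix.mul_assoc (squareCols Q Γ), hB, Matrix.one_mul, e1]
    · rw [Matrix.mul_assoc, ← Matrix.mul_assoc _ _ (squareCols Q Γ), e2, Matrix.one_mul, hB']
  have h3 : unfoldAngle Q * (((1 : Matrix (Fin r) (Fin r) ℂ) ⊗ₖ Y) * squareCols Q Γ) *
      (B * ((Hᵀ)⁻¹ ⊗ₖ X⁻¹)) = unfoldAngle fun a => H⁻¹ * Q a * (Y * X⁻¹) := by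
    rw [Matrix.mul_assoc, Matrix.mul_assoc, ← Matrix.mul_assoc (squareCols Q Γ), hB,
      Matrix.one_mul, ← Matrix.mul_kronecker_mul, Matrix.one_mul, unfoldAngle_mul_kronecker,
      Matrix.transpose_nonsing_inv, Matrix.transpose_transpose]
  rw [nextCore, h1, h2, h3]
  rfl

/-- The gauge matrices of the computed cores: those of the first core are given, the others are
determined by the slice `Z` at which the tensor is read. -/
noncomputable def gaugeSeq {r : ℕ} (e : ℕ) (Z G₀ G₁ : Matrix (Fin r) (Fin r) ℂ) :
    ℕ → Matrix (Fin r) (Fin r) ℂ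
  | 0 => G₀
  | 1 => G₁
  | k + 2 => Z ^ e * Z⁻¹ ^ k * G₀

theorem isUnit_gaugeSeq {r e : ℕ} {Z G₀ G₁ : Matrix (Fin r) (Fin r) ℂ} (hZ : IsUnit Z)
    (h₀ : IsUnit G₀) (h₁ : IsUnit G₁) (k : ℕ) : IsUnit (gaugeSeq e Z G₀ G₁ k) := by
  match k with
  | 0 => exact h₀
  | 1 => exact h₁
  | k + 2 => exact ((hZ.pow e).mul ((Matrix.isUnit_nonsing_inv_iff.2 hZ).pow k)).mul h₀

/-- For `e = d - 2` this is the gauge at index `d`: the loop closes up although nothing in it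
enforces this. -/
theorem gaugeSeq_add_two {r e : ℕ} {Z G₀ G₁ : Matrix (Fin r) (Fin r) ℂ} (hZ : IsUnit Z) :
    gaugeSeq e Z G₀ G₁ (e + 2) = G₀ := by
  rw [gaugeSeq, Matrix.inv_pow', Matrix.mul_nonsing_inv _
    ((Matrix.isUnit_iff_isUnit_det _).1 (hZ.pow e)), Matrix.one_mul]

theorem coreLoop_eq {n r e : ℕ} {Q : Core n r} {Γ : Finset (Fin n)}
    {B : Matrix Γ (Fin r × Fin r) ℂ} (hB : squareCols Q Γ * B = 1) (hB' : B * squareCols Q Γ = 1)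
    {m : Fin n} (hm : IsUnit (Q m)) {G₀ G₁ : Matrix (Fin r) (Fin r) ℂ} (h₀ : IsUnit G₀)
    (h₁ : IsUnit G₁) {C₀ : Core n r} (hC₀ : ∀ a, C₀ a = G₀⁻¹ * Q a * G₁)
    {N : Matrix (Fin n) Γ ℂ} (hN : N = unfoldAngle Q *
      (((1 : Matrix (Fin r) (Fin r) ℂ) ⊗ₖ (Q m ^ e)) * squareCols Q Γ)) (k : ℕ) :
    (∀ a, (coreLoop (fun _ => N) (fun _ => m) C₀ k).1 a =
      (gaugeSeq e (Q m) G₀ G₁ k)⁻¹ * Q a * gaugeSeq e (Q m) G₀ G₁ (k + 1)) ∧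
    (coreLoop (fun _ => N) (fun _ => m) C₀ k).2 = G₀⁻¹ * Q m ^ k * gaugeSeq e (Q m) G₀ G₁ k := by
  have hG := isUnit_gaugeSeq (e := e) hm h₀ h₁
  have hGd := fun k => (Matrix.isUnit_iff_isUnit_det _).1 (hG k)
  have h₀' := (Matrix.isUnit_iff_isUnit_det _).1 h₀
  induction k with
  | zero =>
    refine ⟨hC₀, ?_⟩
    simp [coreLoop, gaugeSeq, Matrix.nonsing_inv_mul _ h₀']
  | succ k ih =>
    obtain ⟨ih1, ih2⟩ := ih
    constructor
    · intro a
      -- The left gauge of the current core cancels against the accumulated product, leaving `X =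
      -- G₀⁻¹ Z ^ k` with `Z = Q m`. The new right gauge is then `Z ^ e X⁻¹ = Z ^ e Z⁻ᵏ G₀`, the
      -- value in `gaugeSeq`.
      have hnext := nextCore_eq (Y := Q m ^ e) (X := G₀⁻¹ * Q m ^ k)
        (P := (coreLoop (fun _ => N) (fun _ => m) C₀ k).2)
        (C := (coreLoop (fun _ => N) (fun _ => m) C₀ k).1) hB hB'
        ((Matrix.isUnit_nonsing_inv_iff.2 h₀).mul (hm.pow k)) (hG (k + 1)) (fun b => by
          rw [ih1, ih2]
          simp only [Matrix.mul_assoc]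
          rw [Matrix.mul_nonsing_inv_cancel_left _ _ (hGd k)]) a
      rw [← hN, Matrix.mul_inv_rev, Matrix.nonsing_inv_nonsing_inv _ h₀', ← Matrix.inv_pow',
        ← Matrix.mul_assoc (Q m ^ e)] at hnext
      exact hnext
    · rw [coreLoop]
      simp only
      rw [ih1, ih2, pow_succ]
      simp only [Matrix.mul_assoc]
      rw [Matrix.mul_nonsing_inv_cancel_left _ _ (hGd k)]

theorem prod_ofFn_gauge {n r : ℕ} (Q : Core n r) {G : ℕ → Matrix (Fin r) (Fin r) ℂ}
    (hG : ∀ k, IsUnit (G k)) {d : ℕ} (i : Fin d → Fin n) :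
    (List.ofFn fun k : Fin d => (G k.val)⁻¹ * Q (i k) * G (k.val + 1)).prod =
      (G 0)⁻¹ * (List.ofFn fun k => Q (i k)).prod * G d := by
  have hGd := fun k => (Matrix.isUnit_iff_isUnit_det _).1 (hG k)
  induction d with
  | zero => simp [Matrix.nonsing_inv_mul _ (hGd 0)]
  | succ d ih =>
    rw [List.ofFn_succ', List.ofFn_succ', List.concat_eq_append, List.concat_eq_append,
      List.prod_append, List.prod_append, List.prod_singleton, List.prod_singleton]
    simp only [Fin.val_castSucc, Fin.val_last]
    rw [ih fun k => i k.castSucc]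
    simp only [Matrix.mul_assoc]
    rw [Matrix.mul_nonsing_inv_cancel_left _ _ (hGd d)]

namespace Sampling

variable {n d r : ℕ}

theorem isUnit_midProd {Q : Core n r} (hQ : IsRegular Q) (α : Fin (d - 2) → Fin n) :
    IsUnit (midProd Q α) :=
  isUnit_prod_ofFn hQ.isUnit_slice α

theorem isProbe_iff (hd : 3 ≤ d) (hn : r ^ 2 ≤ n) {Q : Core n r}
    (hQ : IsRegular Q) {s : Sampling n d r} {E E' : Matrix (Fin n) (Fin r × Fin r) ℂ} :
    s.IsProbe (s.observe (symTensor d Q)) E E' ↔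
      IsEigenbasis (unfoldAngle Q * ((1 : Matrix (Fin r) (Fin r) ℂ) ⊗ₖ
        (midProd Q s.α * (midProd Q s.β)⁻¹)) * pinv (unfoldAngle Q)) E ∧
      IsEigenbasis (unfoldAngle Q * ((1 : Matrix (Fin r) (Fin r) ℂ) ⊗ₖ
        (midProd Q s.α' * (midProd Q s.β')⁻¹)) * pinv (unfoldAngle Q)) E' := by
  have hA := hQ.isUnit_unfoldAngle hn
  have hd2 : 2 ≤ d := by omega
  obtain ⟨B, hB, hB'⟩ := hQ.squareCols_inv s.Γ s.card_Γ
  obtain ⟨C, hC, hC'⟩ := hQ.squareCols_inv s.Γ' s.card_Γ'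
  rw [IsProbe, sliceα, sliceβ, sliceα', sliceβ', slice_observe hd2, slice_observe hd2,
    slice_observe hd2, slice_observe hd2,
    mul_pinv_of_unfold hA hB hB' _ _ (isUnit_midProd hQ _),
    mul_pinv_of_unfold hA hC hC' _ _ (isUnit_midProd hQ _)]

theorem IsProbe.exists_factorization (hd : 3 ≤ d) (hn : r ^ 2 ≤ n) {Q : Core n r}
    (hQ : IsRegular Q) {s : Sampling n d r} {E E' : Matrix (Fin n) (Fin r × Fin r) ℂ}
    (h : s.IsProbe (s.observe (symTensor d Q)) E E') :
    (∃ (U : Matrix (Fin r) (Fin r) ℂ) (K : Fin r → Matrix (Fin r) (Fin r) ℂ) (u : Fin r → ℂ),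
      Function.Injective u ∧ IsEigendecomposition (midProd Q s.α * (midProd Q s.β)⁻¹) U u ∧
      (∀ t, IsUnit (K t)) ∧
      E = unfoldAngle Q * (((1 : Matrix (Fin r) (Fin r) ℂ) ⊗ₖ U) * Matrix.blockDiagonal K)) ∧
    ∃ (V : Matrix (Fin r) (Fin r) ℂ) (K : Fin r → Matrix (Fin r) (Fin r) ℂ) (v : Fin r → ℂ),
      Function.Injective v ∧ IsEigendecomposition (midProd Q s.α' * (midProd Q s.β')⁻¹) V v ∧
      (∀ t, IsUnit (K t)) ∧
      E' = unfoldAngle Q * (((1 : Matrix (Fin r) (Fin r) ℂ) ⊗ₖ V) * Matrix.blockDiagonal K) := by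
  have hA := hQ.isUnit_unfoldAngle hn
  rw [isProbe_iff hd hn hQ] at h
  obtain ⟨h1, h2⟩ := h
  obtain ⟨U, K, u, hU⟩ := h1.exists_factorization hA
  obtain ⟨V, K', v, hV⟩ := h2.exists_factorization hA
  exact ⟨⟨U, K, u, hU⟩, V, K', v, hV⟩

theorem coreProd_eq [NeZero r] (hd : 3 ≤ d) {Q : Core n r} (hQ : IsRegular Q)
    (s : Sampling n d r) {E E' : Matrix (Fin n) (Fin r × Fin r) ℂ}
    {G₀ G₁ : Matrix (Fin r) (Fin r) ℂ} (h₀ : IsUnit G₀) (h₁ : IsUnit G₁)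
    (h : ∀ a, firstCore E E' a = G₀⁻¹ * Q a * G₁) (i : Fin d → Fin n) :
    s.coreProd (s.observe (symTensor d Q)) E E' i =
      G₀⁻¹ * (List.ofFn fun k => Q (i k)).prod * G₀ := by
  obtain ⟨e, rfl⟩ : ∃ e, d = e + 2 := ⟨d - 2, by omega⟩
  obtain ⟨B, hB, hB'⟩ := hQ.squareCols_inv s.Γγ s.card_Γγ
  have hm := hQ.isUnit_slice s.m
  have hN : s.sliceγ (s.observe (symTensor (e + 2) Q)) = unfoldAngle Q *
      (((1 : Matrix (Fin r) (Fin r) ℂ) ⊗ₖ (Q s.m ^ e)) * squareCols Q s.Γγ) := by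
    rw [sliceγ, slice_observe (by omega), midProd, List.ofFn_const, List.prod_replicate]
    rfl
  have hloop := fun k => (coreLoop_eq hB hB' hm h₀ h₁ h hN k).1
  have hprod := prod_ofFn_gauge Q (isUnit_gaugeSeq (e := e) hm h₀ h₁) i
  rw [gaugeSeq_add_two hm] at hprod
  rw [coreProd]
  simp only [cores, hloop]
  exact hprod

theorem exists_coreProd_eq [NeZero r] (hd : 3 ≤ d) (hn : r ^ 2 ≤ n) {Q : Core n r}
    (hQ : IsRegular Q) (s : Sampling n d r) {E E' : Matrix (Fin n) (Fin r × Fin r) ℂ}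
    {U V : Matrix (Fin r) (Fin r) ℂ}
    {K K' : Fin r → Matrix (Fin r) (Fin r) ℂ} (hU : IsUnit U) (hK : ∀ t, IsUnit (K t))
    (hK' : ∀ t, IsUnit (K' t))
    (hE : E = unfoldAngle Q * (((1 : Matrix (Fin r) (Fin r) ℂ) ⊗ₖ U) * Matrix.blockDiagonal K))
    (hE' : E' = unfoldAngle Q * (((1 : Matrix (Fin r) (Fin r) ℂ) ⊗ₖ V) * Matrix.blockDiagonal K'))
    (hW : ∀ t, (U⁻¹ * V) t 0 ≠ 0) :
    ∃ G : Matrix (Fin r) (Fin r) ℂ, IsUnit G ∧ ∀ i : Fin d → Fin n,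
      s.coreProd (s.observe (symTensor d Q)) E E' i =
        G⁻¹ * (List.ofFn fun k => Q (i k)).prod * G := by
  have hfirst := firstCore_eq (hQ.isUnit_unfoldAngle hn) hU hK hK' hE hE' hW
  have hD : IsUnit (Matrix.diagonal fun t => (U⁻¹ * V) t 0 / (U⁻¹ * V) 0 0) := by
    rw [Matrix.isUnit_iff_isUnit_det, Matrix.det_diagonal, isUnit_iff_ne_zero,
      Finset.prod_ne_zero_iff]
    exact fun t _ => div_ne_zero (hW t) (hW 0)
  have hK0 : IsUnit (K 0)ᵀ := (Matrix.isUnit_transpose _).2 (hK 0)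
  exact ⟨((K 0)ᵀ)⁻¹, Matrix.isUnit_nonsing_inv_iff.2 hK0,
    s.coreProd_eq hd hQ (Matrix.isUnit_nonsing_inv_iff.2 hK0) (hU.mul hD) fun a => by
      rw [Matrix.nonsing_inv_nonsing_inv _ ((Matrix.isUnit_iff_isUnit_det _).1 hK0), hfirst]⟩

end Sampling

/-! ### From equal products of slices to gauge equivalence. -/

/-- The product is `f m ^ k * f a * f m ^ (d - 1 - k)`; the extra factor on the left avoids the
subtraction. -/
theorem prod_ofFn_ite_mul_pow {M ι : Type*} [Monoid M] (f : ι → M) (a m : ι) {d : ℕ} (k : Fin d) :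
    (List.ofFn fun j => f (if j = k then a else m)).prod * f m ^ (k.val + 1) =
      f m ^ k.val * f a * f m ^ d := by
  induction d with
  | zero => exact k.elim0
  | succ d ih =>
    rw [List.ofFn_succ, List.prod_cons]
    refine Fin.cases ?_ (fun k => ?_) k
    · simp [Fin.succ_ne_zero, pow_succ, mul_assoc]
    · have := ih k
      simp only [Fin.succ_inj, Fin.val_succ, (Fin.succ_ne_zero k).symm, if_false]
      rw [pow_succ (f m) (k.val + 1), mul_assoc, ← mul_assoc (List.prod _), this, pow_succ (f m) d,
        pow_succ' (f m) k.val]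
      simp only [mul_assoc]

theorem gaugeEquiv_of_prod_eq {n r d : ℕ} (hd : d ≠ 0) {Q C : Core n r} (m : Fin n)
    (hm : IsUnit (Q m)) {G : Matrix (Fin r) (Fin r) ℂ} (hG : IsUnit G)
    (h : ∀ i : Fin d → Fin n, G⁻¹ * (List.ofFn fun k => Q (i k)).prod * G =
      (List.ofFn fun k => C (i k)).prod) :
    GaugeEquiv (fun _ : Fin d => Q) (fun _ : Fin d => C) := by
  have hpow := h fun _ => m
  simp only [List.ofFn_const, List.prod_replicate] at hpow
  have hc : IsUnit (C m) := by
    rw [← isUnit_pow_iff hd, ← hpow]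
    exact ((Matrix.isUnit_nonsing_inv_iff.2 hG).mul (hm.pow d)).mul hG
  obtain ⟨z, hz⟩ := hm
  obtain ⟨c, hc⟩ := hc
  obtain ⟨g, rfl⟩ := hG
  rw [← hz, ← hc, ← Matrix.coe_units_inv] at hpow
  have hpow' : z ^ d * g = g * c ^ d := by
    apply Units.ext
    push_cast
    rw [← hpow, Matrix.mul_assoc, Units.mul_inv_cancel_left]
  -- These gauges are forced up to the choice of `L 0 = g`, since `L k⁻¹ z L (k + 1) = c` for the
  -- slices `z`, `c` at `m`. The constant multi-index `m` gives `z ^ d * g = g * c ^ d`, which is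
  -- the cyclic condition `L d = L 0`.
  let L : ℕ → (Matrix (Fin r) (Fin r) ℂ)ˣ := fun k => (z ^ k)⁻¹ * g * c ^ k
  have hL : L d = L 0 := by
    simp only [L, pow_zero, inv_one, one_mul, mul_one]
    rw [mul_assoc, ← hpow', inv_mul_cancel_left]
  have hrot : ∀ k : Fin d, L (finRotate d k).val = L (k.val + 1) := by
    intro k
    obtain ⟨e, rfl⟩ := Nat.exists_eq_succ_of_ne_zero hd
    by_cases hk : k = Fin.last e
    · rw [hk, finRotate_last, Fin.val_last]
      exact hL.symm
    · rw [coe_finRotate_of_ne_last hk]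
  refine ⟨fun k => L k.val, fun k a => ?_⟩
  show C a = ((L k.val)⁻¹).val * Q a * (L (finRotate d k).val).val
  rw [hrot]
  -- One slice `a` at position `k` among slices at `m` can be solved for `C a`, because `z` and `c`
  -- are invertible.
  have hk := h fun j => if j = k then a else m
  have h1 := prod_ofFn_ite_mul_pow Q a m k
  have h2 := prod_ofFn_ite_mul_pow C a m k
  simp only [← hk, ← hc, ← Units.val_pow_eq_pow_val, ← Matrix.coe_units_inv] at h2
  simp only [← hz, ← Units.val_pow_eq_pow_val] at h1
  have h3 : (List.ofFn fun j => Q (if j = k then a else m)).prod =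
      (z ^ k.val).val * Q a * (z ^ d).val * ((z ^ (k.val + 1))⁻¹).val := by
    rw [← h1, Units.mul_inv_cancel_right]
  have h4 : C a = ((c ^ k.val)⁻¹).val * (((g⁻¹ : (Matrix (Fin r) (Fin r) ℂ)ˣ).val *
      ((z ^ k.val).val * Q a * (z ^ d).val * ((z ^ (k.val + 1))⁻¹).val) * g.val) *
      (c ^ (k.val + 1)).val) * ((c ^ d)⁻¹).val := by
    rw [← h3, h2]
    simp only [Matrix.mul_assoc, Units.mul_inv, Units.inv_mul_cancel_left,
      Matrix.mul_one]
  rw [h4]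
  have h5 : z ^ d * (z ^ (k.val + 1))⁻¹ * g * c ^ (k.val + 1) * (c ^ d)⁻¹ = L (k.val + 1) := by
    have e1 : z ^ d * (z ^ (k.val + 1))⁻¹ = (z ^ (k.val + 1))⁻¹ * z ^ d :=
      ((Commute.refl z).pow_pow d (k.val + 1)).inv_right.eq
    have e2 : c ^ (k.val + 1) * (c ^ d)⁻¹ = (c ^ d)⁻¹ * c ^ (k.val + 1) :=
      ((Commute.refl c).pow_pow (k.val + 1) d).inv_right.eq
    rw [e1, mul_assoc _ (z ^ d), hpow', mul_assoc, e2, ← mul_assoc, ← mul_assoc]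
    simp only [L, mul_assoc, mul_inv_cancel_left]
  have h6 : (L k.val)⁻¹ = (c ^ k.val)⁻¹ * g⁻¹ * z ^ k.val := by
    simp only [L, _root_.mul_inv_rev, inv_inv, mul_assoc]
  rw [← h5, h6]
  simp only [Units.val_mul, Matrix.mul_assoc]

/-- On a regular core, a completed run returns the core up to gauge. -/
theorem Sampling.Run.gaugeEquiv_output {n d r : ℕ} [NeZero n] [NeZero r] (hd : 3 ≤ d)
    (hr : 2 ≤ r) (hn : r ^ 2 ≤ n) {Q : Core n r} (hQ : IsRegular Q) {s : Sampling n d r}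
    (R : s.Run (s.observe (symTensor d Q))) :
    GaugeEquiv (fun _ : Fin d => Q) (fun _ : Fin d => R.output) := by
  have hA := hQ.isUnit_unfoldAngle hn
  have hd0 : d ≠ 0 := by omega
  have : Nonempty (Fin r) := ⟨0⟩
  obtain ⟨⟨U, K, u, -, ⟨hU, -⟩, hK, hE⟩, V, K', v, -, ⟨hV, -⟩, hK', hE'⟩ :=
    R.probe.exists_factorization hd hn hQ
  have hblock := probeBlock_eq hA hU hK hE hE'
  have hW : ∀ t, (U⁻¹ * V) t 0 ≠ 0 := by
    intro t h0
    -- For `t ≠ 0` the run has inverted the block `(t, 0)`. For `t = 0`, a zero entry makes the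
    -- first core zero, hence all eigenvalues and their roots, which contradicts the invertibility
    -- of the candidate for the first slice.
    by_cases ht : t = 0
    · subst ht
      have hfirst : firstCore R.E R.E' = 0 :=
        firstCore_eq_zero hr (by rw [hblock, h0, zero_smul])
      have hprod : s.coreProd (s.observe (symTensor d Q)) R.E R.E' (fun _ => 0) = 0 := by
        refine List.prod_eq_zero (List.mem_ofFn.2 ⟨⟨0, by omega⟩, ?_⟩)
        simp only [cores, coreLoop, hfirst, Pi.zero_apply]
      have heig := R.eigen.2
      have hY := (Matrix.isUnit_iff_isUnit_det _).1 R.eigen.1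
      rw [hprod] at heig
      have hdiag : Matrix.diagonal R.ev = 0 := by
        calc Matrix.diagonal R.ev = R.Y⁻¹ * (R.Y * Matrix.diagonal R.ev * R.Y⁻¹) * R.Y := by
              rw [Matrix.mul_assoc R.Y, Matrix.nonsing_inv_mul_cancel_left _ _ hY,
                Matrix.nonsing_inv_mul_cancel_right _ _ hY]
          _ = 0 := by rw [← heig, Matrix.mul_zero, Matrix.zero_mul]
      have hev : ∀ t, R.ev t = 0 := fun t => by
        simpa using congrFun (congrFun hdiag t) t
      have hroot : (fun t => dthRoot d (R.ev t) (R.k t).val) = 0 := by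
        ext t
        have := dthRoot_pow hd0 (R.ev t) (R.k t).val
        rw [hev] at this ⊢
        exact pow_eq_zero_iff hd0 |>.1 this
      have hhead := R.head_invertible
      rw [candidateHead, hroot] at hhead
      simp at hhead
    · have := R.probe_invertible t ht
      rw [hblock, h0, zero_smul] at this
      exact not_isUnit_zero this
  obtain ⟨G, hG, hprod⟩ := s.exists_coreProd_eq hd hn hQ hU hK hK' hE hE' hW
  exact gaugeEquiv_of_prod_eq hd0 s.m (hQ.isUnit_slice s.m) hG
    fun i => (hprod i).symm.trans (R.accepts i)

/-! ### Completion of the algorithm -/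

theorem IsEigendecomposition.smul {r : ℕ} {S U : Matrix (Fin r) (Fin r) ℂ} {u : Fin r → ℂ}
    (h : IsEigendecomposition S U u) (c : ℂ) : IsEigendecomposition (c • S) U (c • u) := by
  refine ⟨h.1, ?_⟩
  rw [Matrix.diagonal_smul, Matrix.mul_smul, Matrix.smul_mul, ← h.2]

theorem IsEigendecomposition.ne_zero {r : ℕ} {S U : Matrix (Fin r) (Fin r) ℂ} {u : Fin r → ℂ}
    (h : IsEigendecomposition S U u) (hS : IsUnit S) (t : Fin r) : u t ≠ 0 := by
  rw [Matrix.isUnit_iff_isUnit_det, h.2, Matrix.det_mul, Matrix.det_mul, Matrix.det_diagonal,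
    isUnit_iff_ne_zero] at hS
  exact Finset.prod_ne_zero_iff.1 (right_ne_zero_of_mul (left_ne_zero_of_mul hS)) t
    (Finset.mem_univ t)

/-- The adjugate replaces the inverse in order to stay polynomial; the factor `B.det` changes
neither the eigenvectors nor the simplicity of the spectrum. -/
theorem mul_adjugate_eq_smul {r : ℕ} (A : Matrix (Fin r) (Fin r) ℂ) {B : Matrix (Fin r) (Fin r) ℂ}
    (hB : IsUnit B) : A * B.adjugate = B.det • (A * B⁻¹) := by
  have hB' := (Matrix.isUnit_iff_isUnit_det _).1 hB
  rw [Matrix.inv_def, Matrix.mul_smul, smul_smul, Ring.mul_inverse_cancel _ hB', one_smul]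

theorem exists_eigendecomposition_mul_inv {r : ℕ} {A B : Matrix (Fin r) (Fin r) ℂ}
    (hB : IsUnit B) (h : discrDet (A * B.adjugate) ≠ 0) :
    ∃ (U : Matrix (Fin r) (Fin r) ℂ) (u : Fin r → ℂ),
      IsEigendecomposition (A * B⁻¹) U u ∧ Function.Injective u := by
  have hB' := ((Matrix.isUnit_iff_isUnit_det _).1 hB).ne_zero
  obtain ⟨U, u, hU, hu⟩ := exists_eigendecomposition_of_discrDet_ne_zero h
  refine ⟨U, B.det⁻¹ • u, ?_, fun i j hij => hu ?_⟩
  · have := hU.smul B.det⁻¹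
    rwa [mul_adjugate_eq_smul A hB, smul_smul, inv_mul_cancel₀ hB', one_smul] at this
  · simpa [hB'] using hij

theorem discrDet_mul_adjugate_ne_zero {r : ℕ} {A B U : Matrix (Fin r) (Fin r) ℂ} {u : Fin r → ℂ}
    (hB : IsUnit B) (hU : IsEigendecomposition (A * B⁻¹) U u) (hu : Function.Injective u) :
    discrDet (A * B.adjugate) ≠ 0 := by
  have hB' := ((Matrix.isUnit_iff_isUnit_det _).1 hB).ne_zero
  rw [mul_adjugate_eq_smul A hB, (hU.smul B.det).2, discrDet_conj_diagonal_ne_zero_iff hU.1]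
  intro i j hij
  exact hu (by simpa [hB'] using hij)

theorem krylovDet_mul_adjugate_ne_zero_iff {r : ℕ} {A B A' B' U V : Matrix (Fin r) (Fin r) ℂ}
    {u v : Fin r → ℂ} (hB : IsUnit B) (hB' : IsUnit B')
    (hU : IsEigendecomposition (A * B⁻¹) U u) (hu : Function.Injective u)
    (hV : IsEigendecomposition (A' * B'⁻¹) V v) (hv : Function.Injective v) :
    krylovDet (A * B.adjugate) (A' * B'.adjugate) ≠ 0 ↔ ∀ i j, (U⁻¹ * V) i j ≠ 0 := by
  have h1 := ((Matrix.isUnit_iff_isUnit_det _).1 hB).ne_zero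
  have h2 := ((Matrix.isUnit_iff_isUnit_det _).1 hB').ne_zero
  rw [mul_adjugate_eq_smul A hB, mul_adjugate_eq_smul A' hB', (hU.smul B.det).2,
    (hV.smul B'.det).2]
  refine krylovDet_ne_zero_iff hU.1 hV.1 (fun i j hij => hu ?_) (fun i j hij => hv ?_)
  · simpa [h1] using hij
  · simpa [h2] using hij

theorem prod_ofFn_smul {r d : ℕ} (c : ℂ) (f : Fin d → Matrix (Fin r) (Fin r) ℂ) :
    (List.ofFn fun k => c • f k).prod = c ^ d • (List.ofFn f).prod := by
  induction d with
  | zero => simp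
  | succ d ih =>
    rw [List.ofFn_succ, List.ofFn_succ, List.prod_cons, List.prod_cons, ih, Matrix.smul_mul,
      Matrix.mul_smul, smul_smul, pow_succ']

theorem prod_ofFn_smul_conj {n r d : ℕ} (Q : Core n r) {G : Matrix (Fin r) (Fin r) ℂ}
    (hG : IsUnit G) (c : ℂ) (i : Fin d → Fin n) :
    (List.ofFn fun k => c • (G⁻¹ * Q (i k) * G)).prod =
      c ^ d • (G⁻¹ * (List.ofFn fun k => Q (i k)).prod * G) := by
  rw [prod_ofFn_smul]
  congr 1
  exact prod_ofFn_gauge Q (G := fun _ => G) (fun _ => hG) i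

/-- If the `d`-th power of `M` has a simple spectrum, then `M` is, up to a root of unity, obtained
by extracting roots of the eigenvalues of the power. -/
theorem exists_candidateHead_eq {r d : ℕ} [NeZero r] (hd : d ≠ 0)
    {M Y : Matrix (Fin r) (Fin r) ℂ} {ev : Fin r → ℂ} (hM : IsUnit M)
    (hY : IsEigendecomposition (M ^ d) Y ev) (hev : Function.Injective ev) :
    ∃ (k : Fin r → Fin d) (c : ℂ), (k 0).val = 0 ∧ c ^ d = 1 ∧
      Sampling.candidateHead d Y ev k = c • M := by
  have hY' := (Matrix.isUnit_iff_isUnit_det _).1 hY.1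
  have hne := hY.ne_zero (hM.pow d)
  have hMX : M = Y * (Y⁻¹ * M * Y) * Y⁻¹ := by
    simp only [Matrix.mul_assoc]
    rw [Matrix.mul_nonsing_inv _ hY', Matrix.mul_one, Matrix.mul_nonsing_inv_cancel_left _ _ hY']
  have hdiag : Y⁻¹ * M ^ d * Y = Matrix.diagonal ev := by
    rw [hY.2]
    simp only [Matrix.mul_assoc]
    rw [Matrix.nonsing_inv_mul _ hY', Matrix.mul_one, Matrix.nonsing_inv_mul_cancel_left _ _ hY']
  -- `M` commutes with `M ^ d`, whose spectrum is simple, so `Y` diagonalizes `M` as well.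
  have hX := eq_diagonal_of_commute (M := Y⁻¹ * M * Y) hev (by
    rw [← hdiag]
    simp only [Matrix.mul_assoc]
    rw [Matrix.mul_nonsing_inv_cancel_left _ _ hY', Matrix.mul_nonsing_inv_cancel_left _ _ hY',
      ← Matrix.mul_assoc M, ← Matrix.mul_assoc (M ^ d), ← pow_succ, ← pow_succ'])
  set ρ : Fin r → ℂ := fun t => (Y⁻¹ * M * Y) t t with hρ
  rw [hX] at hMX
  have hρd : ∀ t, ρ t ^ d = ev t := by
    have h1 : M ^ d = Y * Matrix.diagonal (fun t => ρ t ^ d) * Y⁻¹ := by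
      have h2 := aeval_conj_diagonal hY.1 ρ (Polynomial.X ^ d)
      rw [← hMX] at h2
      simpa using h2
    rw [h1] at hdiag
    simp only [Matrix.mul_assoc] at hdiag
    rw [Matrix.nonsing_inv_mul _ hY', Matrix.mul_one,
      Matrix.nonsing_inv_mul_cancel_left _ _ hY'] at hdiag
    exact fun t => congrFun (Matrix.diagonal_injective hdiag) t
  have hρ0 : ρ 0 ≠ 0 := by
    intro h
    apply hne 0
    rw [← hρd, h, zero_pow hd]
  -- The search fixes root number `0` for the first eigenvalue; `c` rescales `M` so that its first
  -- eigenvalue is that root. The other roots are then chosen to match `c * ρ t`.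
  let c := dthRoot d (ev 0) 0 / ρ 0
  have hc : c ^ d = 1 := by
    rw [div_pow, dthRoot_pow hd, hρd, div_self (hne 0)]
  choose k hk using fun t => exists_dthRoot_eq hd (z := ev t) (w := c * ρ t) (hne t)
    (by rw [mul_pow, hc, one_mul, hρd])
  refine ⟨fun t => if t = 0 then ⟨0, Nat.pos_of_ne_zero hd⟩ else k t, c, by simp, hc, ?_⟩
  rw [Sampling.candidateHead]
  conv_rhs => rw [hMX, ← Matrix.smul_mul, ← Matrix.mul_smul, ← Matrix.diagonal_smul]
  congr 3
  ext t
  by_cases ht : t = 0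
  · subst ht
    simp only [if_true, Pi.smul_apply, smul_eq_mul, c]
    rw [div_mul_cancel₀ _ hρ0]
  · simp only [if_neg ht, hk, Pi.smul_apply, smul_eq_mul]

namespace Sampling

variable {n d r : ℕ}

theorem accepts_candidate [NeZero n] [NeZero r] (hd : d ≠ 0) {Q : Core n r}
    (h0 : IsUnit (Q 0)) {s : Sampling n d r} {D : s.Data}
    {E E' : Matrix (Fin n) (Fin r × Fin r) ℂ} {G : Matrix (Fin r) (Fin r) ℂ} (hG : IsUnit G)
    (hprod : ∀ i, s.coreProd D E E' i = G⁻¹ * (List.ofFn fun k => Q (i k)).prod * G)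
    {Y : Matrix (Fin r) (Fin r) ℂ} {ev : Fin r → ℂ} {k : Fin r → Fin d} {c : ℂ} (hc : c ^ d = 1)
    (hhead : candidateHead d Y ev k = c • (G⁻¹ * Q 0 * G)) :
    s.Accepts D E E' (s.candidate D E E' Y ev k) := by
  have hGd := (Matrix.isUnit_iff_isUnit_det _).1 hG
  have hc0 : c ≠ 0 := by
    rintro rfl
    rw [zero_pow hd] at hc
    exact zero_ne_one hc
  have hcand : ∀ j, s.candidate D E E' Y ev k j = c • (G⁻¹ * Q j * G) := by
    intro j
    rw [candidate]
    split_ifs with hj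
    · rw [hj, hhead]
    · have hunit : IsUnit (candidateHead d Y ev k ^ (d - 1)) := by
        rw [hhead]
        exact ((((Matrix.isUnit_nonsing_inv_iff.2 hG).mul h0).mul hG).smul (Units.mk0 c hc0)).pow _
      have hpow : candidateHead d Y ev k ^ (d - 1) = c ^ (d - 1) • (G⁻¹ * Q 0 ^ (d - 1) * G) := by
        have := prod_ofFn_smul_conj Q hG c (fun _ : Fin (d - 1) => 0)
        simpa [List.ofFn_const, List.prod_replicate, ← hhead] using this
      -- The scalar `c ^ (d - 1)` of the power and the scalar `c` of the last slice multiply to `1`.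
      have hlast : s.coreProd D E E' (fun t => if t.val = d - 1 then j else 0) =
          candidateHead d Y ev k ^ (d - 1) * (c • (G⁻¹ * Q j * G)) := by
        have h1 : (List.ofFn fun t : Fin d => Q (if t.val = d - 1 then j else 0)).prod =
            Q 0 ^ (d - 1) * Q j := by
          obtain ⟨e, rfl⟩ := Nat.exists_eq_succ_of_ne_zero hd
          rw [List.ofFn_succ', List.concat_eq_append, List.prod_append, List.prod_singleton]
          have h2 : ∀ t : Fin e, t.val ≠ e := fun t => t.isLt.ne
          simp [h2, List.ofFn_const, List.prod_replicate]
        rw [hprod, h1, hpow, Matrix.smul_mul, Matrix.mul_smul, smul_smul, ← pow_succ,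
          Nat.sub_add_cancel (Nat.one_le_iff_ne_zero.2 hd), hc, one_smul]
        simp only [Matrix.mul_assoc]
        rw [Matrix.mul_nonsing_inv_cancel_left _ _ hGd]
      rw [hlast, Matrix.nonsing_inv_mul_cancel_left _ _ ((Matrix.isUnit_iff_isUnit_det _).1 hunit)]
  intro i
  simp only [hcand]
  rw [prod_ofFn_smul_conj Q hG, hc, one_smul, hprod]

/-- The algorithm completes on regular cores for which the spectra that it meets are simple and
the eigenbases of the two probes are in general position. -/
theorem completes_of_isRegular [NeZero n] [NeZero r] (hd : 3 ≤ d) (hn : r ^ 2 ≤ n) {Q : Core n r}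
    (hQ : IsRegular Q) (s : Sampling n d r) (hpow : discrDet (Q 0 ^ d) ≠ 0)
    (hα : discrDet (midProd Q s.α * (midProd Q s.β).adjugate) ≠ 0)
    (hα' : discrDet (midProd Q s.α' * (midProd Q s.β').adjugate) ≠ 0)
    (hK : krylovDet (midProd Q s.α * (midProd Q s.β).adjugate)
      (midProd Q s.α' * (midProd Q s.β').adjugate) ≠ 0) :
    s.Completes (s.observe (symTensor d Q)) := by
  have hd0 : d ≠ 0 := by omega
  have hA := hQ.isUnit_unfoldAngle hn
  have hunit := fun α : Fin (d - 2) → Fin n => isUnit_midProd (d := d) hQ α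
  have hinv : ∀ α β : Fin (d - 2) → Fin n, IsUnit (midProd Q α * (midProd Q β)⁻¹) :=
    fun α β => (hunit α).mul (Matrix.isUnit_nonsing_inv_iff.2 (hunit β))
  refine ⟨?_, fun E E' hE => ?_⟩
  · obtain ⟨U, u, hU, hu⟩ := exists_eigendecomposition_mul_inv (hunit s.β) hα
    obtain ⟨V, v, hV, hv⟩ := exists_eigendecomposition_mul_inv (hunit s.β') hα'
    exact ⟨_, _, (isProbe_iff hd hn hQ).2
      ⟨isEigenbasis_of_eigendecomposition hA hU hu (hU.ne_zero (hinv _ _)),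
        isEigenbasis_of_eigendecomposition hA hV hv (hV.ne_zero (hinv _ _))⟩⟩
  obtain ⟨⟨U, K, u, hu, hU, hKu, hE⟩, V, K', v, hv, hV, hKu', hE'⟩ :=
    hE.exists_factorization hd hn hQ
  -- Only column `0` of `U⁻¹ * V` is used, but the second probe may list its eigenvalues in any
  -- order, so every column has to be free of zeros.
  have hW := (krylovDet_mul_adjugate_ne_zero_iff (hunit s.β) (hunit s.β') hU hu hV hv).1 hK
  obtain ⟨G, hG, hprod⟩ := s.exists_coreProd_eq hd hn hQ hU.1 hKu hKu' hE hE' fun t => hW t 0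
  have hGd := (Matrix.isUnit_iff_isUnit_det _).1 hG
  have h0 := hQ.isUnit_slice 0
  have hH : s.coreProd (s.observe (symTensor d Q)) E E' (fun _ => 0) = G⁻¹ * Q 0 ^ d * G := by
    rw [hprod, List.ofFn_const, List.prod_replicate]
  refine ⟨fun t _ => ?_, ?_, fun Y ev hY => ?_⟩
  · rw [probeBlock_eq hA hU.1 hKu hE hE']
    exact ((Matrix.isUnit_nonsing_inv_iff.2 (hKu t)).mul (hKu' 0)).smul (Units.mk0 _ (hW t 0))
  · obtain ⟨X, ev, hX, -⟩ := exists_eigendecomposition_of_discrDet_ne_zero hpow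
    refine ⟨G⁻¹ * X, ev, (Matrix.isUnit_nonsing_inv_iff.2 hG).mul hX.1, ?_⟩
    rw [hH, hX.2, Matrix.mul_inv_rev, Matrix.nonsing_inv_nonsing_inv _ hGd]
    simp only [Matrix.mul_assoc]
  rw [hH] at hY
  -- Transporting by `G` lets the discriminant of `Q 0 ^ d` show that any eigendecomposition found
  -- in the run has distinct eigenvalues.
  have hGY : IsEigendecomposition (Q 0 ^ d) (G * Y) ev := by
    refine ⟨hG.mul hY.1, ?_⟩
    have : Q 0 ^ d = G * (G⁻¹ * Q 0 ^ d * G) * G⁻¹ := by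
      simp only [Matrix.mul_assoc]
      rw [Matrix.mul_nonsing_inv _ hGd, Matrix.mul_one, Matrix.mul_nonsing_inv_cancel_left _ _ hGd]
    rw [this, hY.2, Matrix.mul_inv_rev]
    simp only [Matrix.mul_assoc]
  have hev : Function.Injective ev := by
    rwa [hGY.2, discrDet_conj_diagonal_ne_zero_iff hGY.1] at hpow
  have hne := hGY.ne_zero (h0.pow d)
  constructor
  · intro k _
    refine (hY.1.mul ?_).mul (Matrix.isUnit_nonsing_inv_iff.2 hY.1)
    rw [Matrix.isUnit_iff_isUnit_det, Matrix.det_diagonal, isUnit_iff_ne_zero,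
      Finset.prod_ne_zero_iff]
    intro t _ hzero
    apply hne t
    rw [← dthRoot_pow hd0 (ev t) (k t).val, hzero, zero_pow hd0]
  · have hGQ : (G⁻¹ * Q 0 * G) ^ d = G⁻¹ * Q 0 ^ d * G := by
      have := prod_ofFn_smul_conj Q hG 1 (fun _ : Fin d => 0)
      simpa [List.ofFn_const, List.prod_replicate] using this
    obtain ⟨k, c, hk, hc, hhead⟩ := exists_candidateHead_eq hd0
      (((Matrix.isUnit_nonsing_inv_iff.2 hG).mul h0).mul hG) (by rw [hGQ]; exact hY) hev
    exact ⟨k, hk, accepts_candidate hd0 h0 hG hprod hc hhead⟩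

end Sampling

/-! ### Generic cores -/

theorem mapMatrix_varCore {n r : ℕ} (Q : Core n r) (a : Fin n) :
    (evalCore Q).mapMatrix (varCore n r a) = Q a :=
  map_varCore Q a

theorem ae_isUnit_slice {n r : ℕ} (a : Fin n) :
    ∀ᵐ x : Fin n → Fin r → Fin r → ℂ, IsUnit (toCore x a) := by
  have heval : ∀ Q : Core n r, evalCore Q (varCore n r a).det = (Q a).det := fun Q => by
    rw [RingHom.map_det, mapMatrix_varCore]
  filter_upwards [ae_evalCore_ne_zero (varCore n r a).det ⟨fun _ => 1, by simp [heval]⟩] with x hx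
  rwa [Matrix.isUnit_iff_isUnit_det, isUnit_iff_ne_zero, ← heval]

theorem ae_squareCols_inv {n r : ℕ} (Γ : Finset (Fin n)) (hΓ : Γ.card = r ^ 2) :
    ∀ᵐ x : Fin n → Fin r → Fin r → ℂ, ∃ C : Matrix Γ (Fin r × Fin r) ℂ,
      squareCols (toCore x) Γ * C = 1 ∧ C * squareCols (toCore x) Γ = 1 := by
  let e : Γ ≃ Fin r × Fin r := Fintype.equivOfCardEq (by simp [hΓ, sq])
  let P := (Matrix.of fun p q : Fin r × Fin r => varCore n r (e.symm q).val p.2 p.1).det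
  have heval : ∀ Q : Core n r,
      evalCore Q P = ((squareCols Q Γ).submatrix id e.symm).det := fun Q => by
    rw [RingHom.map_det]
    congr 1
    ext p q
    exact congrFun (congrFun (map_varCore Q (e.symm q).val) p.2) p.1
  have hne : ∃ Q : Core n r, evalCore Q P ≠ 0 := by
    -- The slices in `Γ` are the `r ^ 2` matrix units, which turns the minor into the identity.
    refine ⟨fun c => if h : c ∈ Γ then Matrix.single (e ⟨c, h⟩).2 (e ⟨c, h⟩).1 1 else 0, ?_⟩
    rw [heval]
    have : (squareCols (fun c => if h : c ∈ Γ then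
        Matrix.single (e ⟨c, h⟩).2 (e ⟨c, h⟩).1 (1 : ℂ) else 0) Γ).submatrix id e.symm = 1 := by
      ext p q
      simp only [squareCols, unfoldSquare, Matrix.submatrix_apply, Matrix.transpose_apply, id,
        Matrix.of_apply, Finset.coe_mem, dif_pos, Subtype.coe_eta, Equiv.apply_symm_apply,
        Matrix.single_apply, Matrix.one_apply, Prod.ext_iff]
      simp only [eq_comm, and_comm]
    rw [this, Matrix.det_one]
    exact one_ne_zero
  filter_upwards [ae_evalCore_ne_zero P hne] with x hx
  rw [heval] at hx
  set N := (squareCols (toCore x) Γ).submatrix id e.symm with hN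
  have hN' : squareCols (toCore x) Γ = N.submatrix id e := by
    rw [hN, Matrix.submatrix_submatrix]
    simp
  refine ⟨N⁻¹.submatrix e id, ?_, ?_⟩
  · rw [hN', Matrix.submatrix_mul_equiv, Matrix.mul_nonsing_inv _ (isUnit_iff_ne_zero.2 hx),
      Matrix.submatrix_id_id]
  · rw [hN', ← Equiv.coe_refl, Matrix.submatrix_mul_equiv,
      Matrix.nonsing_inv_mul _ (isUnit_iff_ne_zero.2 hx), Matrix.submatrix_one_equiv]

theorem ae_isRegular (n r : ℕ) : ∀ᵐ x : Fin n → Fin r → Fin r → ℂ, IsRegular (toCore x) := by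
  have h1 : ∀ᵐ x : Fin n → Fin r → Fin r → ℂ, ∀ a, IsUnit (toCore x a) :=
    ae_all_iff.2 fun a => ae_isUnit_slice a
  have h2 : ∀ᵐ x : Fin n → Fin r → Fin r → ℂ, ∀ Γ : Finset (Fin n), Γ.card = r ^ 2 →
      ∃ C : Matrix Γ (Fin r × Fin r) ℂ,
        squareCols (toCore x) Γ * C = 1 ∧ C * squareCols (toCore x) Γ = 1 :=
    ae_all_iff.2 fun Γ => ae_all_iff.2 fun hΓ => ae_squareCols_inv Γ hΓ
  filter_upwards [h1, h2] with x hx hx'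
  exact ⟨hx, hx'⟩

theorem isEigendecomposition_diagonal {r : ℕ} (u : Fin r → ℂ) :
    IsEigendecomposition (Matrix.diagonal u) 1 u :=
  ⟨isUnit_one, by simp⟩

theorem ae_discrDet_pow_ne_zero {n r d : ℕ} (hd : d ≠ 0) (a : Fin n) :
    ∀ᵐ x : Fin n → Fin r → Fin r → ℂ, discrDet (toCore x a ^ d) ≠ 0 := by
  have heval : ∀ Q : Core n r, evalCore Q (discrDet (varCore n r a ^ d)) = discrDet (Q a ^ d) :=
    fun Q => by
      rw [map_discrDet, ← RingHom.mapMatrix_apply, map_pow, mapMatrix_varCore]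
  have hne : ∃ Q : Core n r, evalCore Q (discrDet (varCore n r a ^ d)) ≠ 0 := by
    -- The eigenvalues `0, …, r - 1` keep distinct `d`-th powers because they are natural numbers.
    refine ⟨fun _ => Matrix.diagonal fun t => (t.val : ℂ), ?_⟩
    rw [heval, Matrix.diagonal_pow, (isEigendecomposition_diagonal _).2,
      discrDet_conj_diagonal_ne_zero_iff isUnit_one]
    intro i j hij
    simp only [Pi.pow_apply] at hij
    have : i.val ^ d = j.val ^ d := by exact_mod_cast hij
    exact Fin.ext (Nat.pow_left_injective hd this)
  filter_upwards [ae_evalCore_ne_zero _ hne] with x hx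
  rwa [← heval]

namespace Sampling

variable {n d r : ℕ}

theorem mapMatrix_prod_varCore (Q : Core n r) (α : Fin (d - 2) → Fin n) :
    (evalCore Q).mapMatrix (List.ofFn fun k => varCore n r (α k)).prod = midProd Q α := by
  rw [map_list_prod, List.map_ofFn, midProd]
  congr 2
  ext1 k
  exact mapMatrix_varCore Q (α k)

theorem mapMatrix_prod_mul_adjugate (Q : Core n r) (α β : Fin (d - 2) → Fin n) :
    ((List.ofFn fun k => varCore n r (α k)).prod *
      (List.ofFn fun k => varCore n r (β k)).prod.adjugate).map (evalCore Q) =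
      midProd Q α * (midProd Q β).adjugate := by
  rw [← RingHom.mapMatrix_apply, map_mul, RingHom.map_adjugate, mapMatrix_prod_varCore,
    mapMatrix_prod_varCore]

theorem ae_discrDet_mul_adjugate_ne_zero {α β : Fin (d - 2) → Fin n}
    (h : ∃ Q : Core n r, discrDet (midProd Q α * (midProd Q β).adjugate) ≠ 0) :
    ∀ᵐ x : Fin n → Fin r → Fin r → ℂ,
      discrDet (midProd (toCore x) α * (midProd (toCore x) β).adjugate) ≠ 0 := by
  have heval : ∀ Q : Core n r, evalCore Q (discrDet ((List.ofFn fun k => varCore n r (α k)).prod *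
      (List.ofFn fun k => varCore n r (β k)).prod.adjugate)) =
      discrDet (midProd Q α * (midProd Q β).adjugate) := fun Q => by
    rw [map_discrDet, mapMatrix_prod_mul_adjugate]
  simp only [← heval] at h ⊢
  exact ae_evalCore_ne_zero _ h

theorem ae_krylovDet_mul_adjugate_ne_zero {α β α' β' : Fin (d - 2) → Fin n}
    (h : ∃ Q : Core n r, krylovDet (midProd Q α * (midProd Q β).adjugate)
      (midProd Q α' * (midProd Q β').adjugate) ≠ 0) :
    ∀ᵐ x : Fin n → Fin r → Fin r → ℂ,
      krylovDet (midProd (toCore x) α * (midProd (toCore x) β).adjugate)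
        (midProd (toCore x) α' * (midProd (toCore x) β').adjugate) ≠ 0 := by
  have heval : ∀ Q : Core n r, evalCore Q (krylovDet ((List.ofFn fun k => varCore n r (α k)).prod *
      (List.ofFn fun k => varCore n r (β k)).prod.adjugate)
      ((List.ofFn fun k => varCore n r (α' k)).prod *
      (List.ofFn fun k => varCore n r (β' k)).prod.adjugate)) =
      krylovDet (midProd Q α * (midProd Q β).adjugate)
      (midProd Q α' * (midProd Q β').adjugate) := fun Q => by
    rw [map_krylovDet, mapMatrix_prod_mul_adjugate, mapMatrix_prod_mul_adjugate]
  simp only [← heval] at h ⊢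
  exact ae_evalCore_ne_zero _ h

/-- The core in the definition of nondegeneracy need not be regular: it only witnesses that the
discriminants and `krylovDet` are nonzero polynomials. Regularity and the simple spectrum of `Q 0 ^
d` have witnesses of their own. -/
theorem Nondegenerate.ae_completes [NeZero n] [NeZero r] (hd : 3 ≤ d) (hn : r ^ 2 ≤ n)
    {s : Sampling n d r} (hs : s.Nondegenerate) :
    ∀ᵐ x : Fin n → Fin r → Fin r → ℂ, s.Completes (s.observe (symTensor d (toCore x))) := by
  obtain ⟨Q, U, V, u, v, hβ, hβ', hU, hu, hV, hv, hW⟩ := hs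
  filter_upwards [ae_isRegular n r, ae_discrDet_pow_ne_zero (d := d) (by omega) 0,
    ae_discrDet_mul_adjugate_ne_zero ⟨Q, discrDet_mul_adjugate_ne_zero hβ hU hu⟩,
    ae_discrDet_mul_adjugate_ne_zero ⟨Q, discrDet_mul_adjugate_ne_zero hβ' hV hv⟩,
    ae_krylovDet_mul_adjugate_ne_zero
      ⟨Q, (krylovDet_mul_adjugate_ne_zero_iff hβ hβ' hU hu hV hv).2 hW⟩] with x h1 h2 h3 h4 h5
  exact completes_of_isRegular hd hn h1 s h2 h3 h4 h5

/-! ### Choices of the middle indices -/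

theorem midProd_mul_inv_midProd (hd : 3 ≤ d) {Q : Core n r} (hQ : ∀ a, IsUnit (Q a))
    {α β : Fin (d - 2) → Fin n} (h : ∀ i : Fin (d - 2), i.val ≠ 0 → α i = β i) :
    midProd Q α * (midProd Q β)⁻¹ =
      Q (α ⟨0, by omega⟩) * (Q (β ⟨0, by omega⟩))⁻¹ := by
  obtain ⟨e, rfl⟩ : ∃ e, d = e + 3 := ⟨d - 3, by omega⟩
  have hsplit : ∀ α : Fin (e + 1) → Fin n, (List.ofFn fun k => Q (α k)).prod =
      Q (α 0) * (List.ofFn fun k : Fin e => Q (α k.succ)).prod := fun α => by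
    rw [List.ofFn_succ, List.prod_cons]
  have htail : (fun k : Fin e => Q (β k.succ)) = fun k : Fin e => Q (α k.succ) := by
    ext1 k
    rw [h k.succ (by simp)]
  have hunit := isUnit_prod_ofFn hQ fun k : Fin e => α k.succ
  have h1 := hsplit α
  have h2 := hsplit β
  rw [htail] at h2
  have h3 : midProd (d := e + 3) Q α = _ := h1
  have h4 : midProd (d := e + 3) Q β = _ := h2
  rw [h3, h4, Matrix.mul_inv_rev, Matrix.mul_assoc, Matrix.mul_nonsing_inv_cancel_left _ _
    ((Matrix.isUnit_iff_isUnit_det _).1 hunit)]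
  rfl

/-- Prescribed values of the quotients of two different pairs of slices. -/
theorem exists_core_mul_inv_eq {a b a' b' : Fin n} (hab : a ≠ b) (hab' : a' ≠ b')
    (hne : ({a, b} : Set (Fin n)) ≠ {a', b'}) {A B : Matrix (Fin r) (Fin r) ℂ} (hA : IsUnit A)
    (hB : IsUnit B) : ∃ Q : Core n r, (∀ c, IsUnit (Q c)) ∧ Q a * (Q b)⁻¹ = A ∧
      Q a' * (Q b')⁻¹ = B := by
  have hBd := (Matrix.isUnit_iff_isUnit_det _).1 hB
  let q : Core n r := fun c => if c = a then A else 1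
  have hq : ∀ c, IsUnit (q c) := fun c => by
    simp only [q]
    split_ifs
    exacts [hA, isUnit_one]
  have hqd := fun c => (Matrix.isUnit_iff_isUnit_det _).1 (hq c)
  have hupd : ∀ c M, IsUnit M → ∀ c', IsUnit (Function.update q c M c') := by
    intro c M hM c'
    rcases eq_or_ne c' c with rfl | h
    · rwa [Function.update_self]
    · rw [Function.update_of_ne h]
      exact hq c'
  have hqab : q a * (q b)⁻¹ = A := by simp [q, hab.symm]
  -- Two different pairs: some index of the second lies outside the first, and its slice can be
  -- adjusted without disturbing `q a * (q b)⁻¹`.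
  have hcases : (a' ≠ a ∧ a' ≠ b) ∨ (b' ≠ a ∧ b' ≠ b) := by
    by_contra! hcon
    apply hne
    by_cases h1 : a' = a
    · by_cases h2 : b' = a
      · exact absurd (h1.trans h2.symm) hab'
      · rw [h1, hcon.2 h2]
    · have h2 := hcon.1 h1
      by_cases h3 : b' = a
      · rw [h2, h3, Set.pair_comm]
      · exact absurd (h2.trans (hcon.2 h3).symm) hab'
  rcases hcases with ⟨h1, h2⟩ | ⟨h1, h2⟩
  · refine ⟨Function.update q a' (B * q b'), hupd _ _ (hB.mul (hq b')), ?_, ?_⟩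
    · rw [Function.update_of_ne h1.symm, Function.update_of_ne h2.symm, hqab]
    · rw [Function.update_self, Function.update_of_ne hab'.symm,
        Matrix.mul_nonsing_inv_cancel_right _ _ (hqd b')]
  · refine ⟨Function.update q b' (B⁻¹ * q a'),
      hupd _ _ ((Matrix.isUnit_nonsing_inv_iff.2 hB).mul (hq a')), ?_, ?_⟩
    · rw [Function.update_of_ne h1.symm, Function.update_of_ne h2.symm, hqab]
    · rw [Function.update_self, Function.update_of_ne hab', Matrix.mul_inv_rev,
        Matrix.nonsing_inv_nonsing_inv _ hBd, Matrix.mul_nonsing_inv_cancel_left _ _ (hqd a')]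

theorem DiffersInFirst.nondegenerate (hd : 3 ≤ d) {s : Sampling n d r} (hs : s.DiffersInFirst) :
    s.Nondegenerate := by
  obtain ⟨h1, h2⟩ := hs
  have hfirst : ∀ {α β : Fin (d - 2) → Fin n}, α ≠ β →
      (∀ i : Fin (d - 2), i.val ≠ 0 → α i = β i) → α ⟨0, by omega⟩ ≠ β ⟨0, by omega⟩ := by
    intro α β hne h h0
    apply hne
    ext1 i
    by_cases hi : i.val = 0
    · rwa [show i = ⟨0, by omega⟩ from Fin.ext hi]
    · exact h i hi
  -- The numbers `1, …, r` serve both as eigenvalues and as Vandermonde nodes. With `U = 1` and `V`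
  -- the Vandermonde matrix, the entries of `U⁻¹ * V` are powers of nonzero numbers.
  let u : Fin r → ℂ := fun t => (t.val : ℂ) + 1
  have hu : Function.Injective u := by
    intro i j hij
    have : (i.val : ℂ) = j.val := add_right_cancel hij
    exact Fin.ext (by exact_mod_cast this)
  have hu0 : ∀ t, u t ≠ 0 := fun t => Nat.cast_add_one_ne_zero t.val
  have hD : IsUnit (Matrix.diagonal u) := by
    rw [Matrix.isUnit_iff_isUnit_det, Matrix.det_diagonal, isUnit_iff_ne_zero,
      Finset.prod_ne_zero_iff]
    exact fun t _ => hu0 t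
  have hV : IsUnit (Matrix.vandermonde u) := by
    rw [Matrix.isUnit_iff_isUnit_det, isUnit_iff_ne_zero]
    exact Matrix.det_vandermonde_ne_zero_iff.2 hu
  obtain ⟨Q, hQ, hA, hB⟩ := exists_core_mul_inv_eq
    (hfirst s.ne fun i hi => (h1 i hi).1) (hfirst s.ne' fun i hi => (h1 i hi).2)
    (h2 ⟨0, by omega⟩ rfl) hD ((hV.mul hD).mul (Matrix.isUnit_nonsing_inv_iff.2 hV))
  refine ⟨Q, 1, Matrix.vandermonde u, u, u, isUnit_prod_ofFn hQ _, isUnit_prod_ofFn hQ _, ?_, hu,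
    ?_, hu, fun i j => ?_⟩
  · rw [midProd_mul_inv_midProd hd hQ fun i hi => (h1 i hi).1, hA]
    exact isEigendecomposition_diagonal u
  · rw [midProd_mul_inv_midProd hd hQ fun i hi => (h1 i hi).2, hB]
    exact ⟨hV, rfl⟩
  · rw [inv_one, Matrix.one_mul, Matrix.vandermonde_apply]
    exact pow_ne_zero _ (hu0 i)

theorem exists_differsInFirst (hd : 3 ≤ d) (hr : 2 ≤ r) (hn : r ^ 2 ≤ n) :
    ∃ s : Sampling n d r, s.DiffersInFirst := by
  have hn4 : 4 ≤ n := le_trans (Nat.pow_le_pow_left hr 2) hn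
  obtain ⟨Γ, -, hΓ⟩ := Finset.exists_subset_card_eq (s := (Finset.univ : Finset (Fin n)))
    (n := r ^ 2) (by simpa using hn)
  -- Middle indices that vary in the first place only; the first entries `0, 1` and `0, 2` give two
  -- different pairs, and `n ≥ r ^ 2 ≥ 4` leaves room for them.
  let p : Fin n → Fin (d - 2) → Fin n := fun c i => if i.val = 0 then c else ⟨0, by omega⟩
  have hp : ∀ c, p c ⟨0, by omega⟩ = c := fun c => if_pos rfl
  have hpinj : Function.Injective p := fun c c' h => by rw [← hp c, ← hp c', h]
  have h01 : (⟨0, by omega⟩ : Fin n) ≠ ⟨1, by omega⟩ := by simp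
  have h02 : (⟨0, by omega⟩ : Fin n) ≠ ⟨2, by omega⟩ := by simp
  have h12 : (⟨1, by omega⟩ : Fin n) ≠ ⟨2, by omega⟩ := by simp
  have hpair : ∀ {ι : Type} {x y z : ι}, x ≠ y → y ≠ z → ({x, y} : Set ι) ≠ {x, z} := by
    intro ι x y z hxy hyz h
    have : y ∈ ({x, z} : Set ι) := h ▸ Set.mem_insert_of_mem _ rfl
    rcases this with h | h
    exacts [hxy h.symm, hyz h]
  refine ⟨⟨p ⟨0, by omega⟩, p ⟨1, by omega⟩, p ⟨0, by omega⟩, p ⟨2, by omega⟩, ⟨0, by omega⟩,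
    Γ, Γ, Γ, hΓ, hΓ, hΓ, hpinj.ne h01, hpinj.ne h02, hpair (hpinj.ne h01) (hpinj.ne h12)⟩, ?_, ?_⟩
  · intro i hi
    simp [p, hi]
  · intro i hi
    simp only [p, hi, if_true]
    exact hpair h01 h12

theorem card_positions_le (s : Sampling n d r) : s.positions.card ≤ 5 * (n * r ^ 2) := by
  have hblock : ∀ (α : Fin (d - 2) → Fin n) (Γ : Finset (Fin n)), Γ.card = r ^ 2 →
      (block d α Γ).card ≤ n * r ^ 2 := fun α Γ hΓ => by
    refine Finset.card_image_le.trans ?_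
    rw [Finset.card_product, Finset.card_univ, Fintype.card_fin, hΓ]
  have h1 := hblock s.α s.Γ s.card_Γ
  have h2 := hblock s.β s.Γ s.card_Γ
  have h3 := hblock s.α' s.Γ' s.card_Γ'
  have h4 := hblock s.β' s.Γ' s.card_Γ'
  have h5 := hblock (fun _ => s.m) s.Γγ s.card_Γγ
  have := Finset.card_union_le (block d s.α s.Γ ∪ block d s.β s.Γ ∪
    (block d s.α' s.Γ' ∪ block d s.β' s.Γ')) (block d (fun _ => s.m) s.Γγ)
  have := Finset.card_union_le (block d s.α s.Γ ∪ block d s.β s.Γ)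
    (block d s.α' s.Γ' ∪ block d s.β' s.Γ')
  have := Finset.card_union_le (block d s.α s.Γ) (block d s.β s.Γ)
  have := Finset.card_union_le (block d s.α' s.Γ') (block d s.β' s.Γ')
  rw [positions]
  omega

end Sampling

end TensorRing

theorem theorem2 (n d r : ℕ) [NeZero n] [NeZero r] (hd : 3 ≤ d) (hr : 2 ≤ r) (hn : r ^ 2 ≤ n)
    (μ : MeasureTheory.Measure (Fin n → Fin r → Fin r → ℂ)) [MeasureTheory.IsProbabilityMeasure μ]
    (hμ : μ.AbsolutelyContinuous MeasureTheory.volume) :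
    -- whatever is returned is the core, up to gauge
    (∀ᵐ x ∂μ, ∀ (s : TensorRing.Sampling n d r)
        (R : s.Run (s.observe (TensorRing.symTensor d (TensorRing.toCore x)))),
        TensorRing.GaugeEquiv (fun _ : Fin d => TensorRing.toCore x) (fun _ : Fin d => R.output)) ∧
    -- the algorithm runs through and returns a core
    (∀ s : TensorRing.Sampling n d r, s.Nondegenerate →
      ∀ᵐ x ∂μ, s.Completes (s.observe (TensorRing.symTensor d (TensorRing.toCore x)))) ∧
    -- choices of the middle indices for which it does
    (∀ s : TensorRing.Sampling n d r, s.DiffersInFirst → s.Nondegenerate) ∧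
    (∃ s : TensorRing.Sampling n d r, s.DiffersInFirst) ∧
    -- the number of entries that are read
    (∀ s : TensorRing.Sampling n d r, s.positions.card ≤ 5 * (n * r ^ 2)) := by
  refine ⟨?_, fun s hs => hμ.ae_le (hs.ae_completes hd hn), fun s hs => hs.nondegenerate hd,
    TensorRing.Sampling.exists_differsInFirst hd hr hn, fun s => s.card_positions_le⟩
  filter_upwards [hμ.ae_le (TensorRing.ae_isRegular n r)] with x hx s R
  exact R.gaugeEquiv_output hd hr hn hx
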